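/- Let $K$ be a commutative ring. **Non-crossing trees.** A non-crossing tree with $n\ge 1$ edges is a tree on the vertices $0,1,\dots,n$ of a convex polygon with no two crossing edges. The base is the side $\{0,n\}$, and the other sides are numbered $1,\dots,n$, side $i$ being $\{i-1,i\}$. An edge of $T$ that is a side $i$ has label $i$. Any other edge $e$ has as label the number of the unique side that is not in $T$ and is separated from the base by $e$ but by no edge of $T$ that $e$ itself separates from the base. Each of $1,\dots,n$ is the label of exactly one edge. Let $P=P(T)$ be the relation on $\{1,\dots,n\}$ with $i<_P j$ iff the edge labelled $i$ is separated from the base by the edge labelled $j$. Let $L(P)$ be the set of linear extensions of $P$, i.e. of permutations $\sigma\in\mathfrak S_n$, written as words $\sigma_1\cdots\sigma_n$, in which $i$ stands before $j$ whenever $i<_P j$. **The operad of non-crossing trees.** Let $\mathrm{NCT}(n)$ be the free $K$-module on the non-crossing trees with $n$ edges. The composite $T(S_1,\dots,S_n)$ is obtained by gluing the polygon of $S_j$, by its base, on the side $j$ of the polygon of $T$, for all $j$. If the side $j$ belongs to $T$, it is replaced by $S_j$. If not, $S_j$ is added and one edge of the path of $S_j$ joining the ends of its base is removed. The composite is the sum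 of the resulting trees over all choices of the removed edges. (Under $T\mapsto\prod_{e}\bigl(\sum_{i}u_i\bigr)^{-1}$, where $i$ runs over the sides below the edge $e$, this is the composition of moulds.) The free NCT-algebra on one generator is $\bigoplus_{n\ge1}\mathrm{NCT}(n)$, the generator being the tree with one edge. The operad is generated by the three trees with two edges. **Dendriform side.** Let $\mathbf{FQSym}$ have basis $(\mathbf F_\sigma)$, with $\mathbf F_\sigma\prec\mathbf F_\tau$ (resp. $\mathbf F_\sigma\succ\mathbf F_\tau$) the sum of the $\mathbf F_\mu$ over the shifted shuffles $\mu$ of $\sigma$ and $\tau$ whose last letter comes from $\sigma$ (resp. from $\tau$). Let $\mathbf{PBT}\subset\mathbf{FQSym}$ be the dendriform subalgebra generated by $\mathbf F_1$; it is the free dendriform algebra on one generator. For a binary tree $t$ with $n$ internal nodes, $\mathbf P_t=\sum\mathbf F_\sigma$ over the $\sigma\in\mathfrak S_n$ such that the decreasing tree of $\sigma^{-1}$ has shape $t$. Dendriform algebras are NCT-algebras: the trees with edge sets $\{02,12\}$, $\{01,02\}$, $\{01,12\}$ act by $\prec$, $\succ$ and $\prec+\succ$. **Theorem.** There is a unique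 morphism of NCT-algebras $\theta$ from the free NCT-algebra on one generator to $\mathbf{PBT}$ that maps the generator to $\mathbf F_1$. For every non-crossing tree $T$ with $n$ edges, $P=P(T)$ is the order of a non-interleaving forest: it is a partial order, the elements above any given one form a chain, and for every $i$ the set $\{j : j\le_P i\}$ is an interval of integers. Moreover $$\theta(T)=\sum_{\sigma\in L(P)}\mathbf F_\sigma=\sum_{t\in I}\mathbf P_t$$ for a set $I$ of binary trees with $n$ internal nodes which is a (non-empty, closed) interval $\{t : s\le t\le s'\}$ of the Tamari order (the reflexive transitive closure of right rotation). -/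

import Mathlib

/-- A non-crossing tree with `n ≥ 1` edges: a tree on the vertices `0, 1, …, n` of a convex
polygon, no two edges of which cross.  The base of the polygon is its side `{0, n}`; the other
sides are numbered from left to right, side number `k : Fin n` being `{k, k + 1}`. -/
structure NCTree (n : ℕ) where
  pos : 0 < n
  graph : SimpleGraph (Fin (n + 1))
  isTree : graph.IsTree
  noncrossing : ∀ a b c d : Fin (n + 1), a < b → b < c → c < d →
    graph.Adj a c → ¬ graph.Adj b d

namespace NCTree

theorem graph_injective (n : ℕ) : Function.Injective (NCTree.graph : NCTree n → _) := by
  rintro ⟨_, _, _, _⟩ ⟨_, _, _, _⟩ h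
  cases h
  rfl

noncomputable instance (n : ℕ) : Fintype (NCTree n) :=
  Fintype.ofInjective _ (graph_injective n)

variable {n : ℕ}

/-- `{a, b}`, with `a < b`, is an edge of `T`. -/
def Edge (T : NCTree n) (a b : Fin (n + 1)) : Prop := a < b ∧ T.graph.Adj a b

/-- The edge `{a, b}` has the number `k`: it is the innermost edge of `T` which is equal to the
side `k` or separates it from the base.  So an edge which is a side has its own number, and any
other edge has the number of the unique side that is not an edge of `T` and that is separated
from the base by this edge, but not by another edge lying below this edge. -/
def HasLabel (T : NCTree n) (a b : Fin (n + 1)) (k : Fin n) : Prop :=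
  T.Edge a b ∧ a ≤ k.castSucc ∧ k.succ ≤ b ∧
    ∀ c d, T.Edge c d → a ≤ c → d ≤ b → c ≤ k.castSucc → k.succ ≤ d → c = a ∧ d = b

/-- The order of the poset `P` of `T`, on the labels: `i ≤ j` iff the edge numbered `i` is the
edge numbered `j` or is separated from the base by it. -/
def posetLE (T : NCTree n) (i j : Fin n) : Prop :=
  ∃ a b c d, T.HasLabel a b i ∧ T.HasLabel c d j ∧ c ≤ a ∧ b ≤ d

/-- `{a, b}` is an edge of `T` which no other edge of `T` separates from the base.  These edges
form the path of `T` from `0` to `n`. -/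
def IsOuter (T : NCTree n) (a b : Fin (n + 1)) : Prop :=
  T.Edge a b ∧ ∀ c d, T.Edge c d → c ≤ a → b ≤ d → c = a ∧ d = b

/-- The only tree with one edge (the unit of the operad of non-crossing trees). -/
def unit : NCTree 1 where
  pos := by decide
  graph := SimpleGraph.starGraph 0
  isTree := SimpleGraph.isTree_starGraph 0
  noncrossing := by intro a b c d; omega

/-- The three trees with two edges; `star r` consists of the two edges at the vertex `r`. -/
def star (r : Fin 3) : NCTree 2 where
  pos := by decide
  graph := SimpleGraph.starGraph r
  isTree := SimpleGraph.isTree_starGraph r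
  noncrossing := by intro a b c d; omega

end NCTree

/-- A relation on `Fin n` is the order of a non-interleaving forest (descendant `≤` ancestor): it
is a partial order, the elements above any element form a chain, and the labels of each subtree
(all the descendants of a vertex, itself included) form an interval. -/
structure IsNonInterleavingForest {n : ℕ} (r : Fin n → Fin n → Prop) : Prop where
  refl : ∀ i, r i i
  antisymm : ∀ i j, r i j → r j i → i = j
  trans : ∀ i j k, r i j → r j k → r i k
  forest : ∀ i j k, r i j → r i k → r j k ∨ r k j
  interval : ∀ i, Set.OrdConnected {j | r j i}

/-- The permutation `σ`, seen as the word `σ 0, σ 1, …, σ (n - 1)`, is a linear extension of `r`: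
smaller elements come first. -/
def IsLinearExtension {n : ℕ} (r : Fin n → Fin n → Prop) (σ : Equiv.Perm (Fin n)) : Prop :=
  ∀ i j, r i j → σ.symm i ≤ σ.symm j

section FreeNCT

/-- The free algebra on one generator over the operad of non-crossing trees: the free module on
all non-crossing trees.  The generator is `NCTree.unit`. -/
abbrev FreeNCT (K : Type*) [CommRing K] : Type _ := (Σ n : ℕ, NCTree n) →₀ K

/-- The basis element of a non-crossing tree. -/
noncomputable def NCTree.basis (K : Type*) [CommRing K] {n : ℕ} (T : NCTree n) : FreeNCT K :=
  Finsupp.single ⟨n, T⟩ 1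

/-- `s 0 + ⋯ + s (a - 1)`: the place of the vertex `a` of a polygon after polygons with
`s 0, s 1, …` non-base sides have been glued on its sides. -/
def offset {n : ℕ} (s : Fin n → ℕ) (a : ℕ) : ℕ := ∑ j : Fin n with j.val < a, s j

/-- `R` is one of the terms of the operadic composite of `T` with `S 0, …, S (n - 1)`.  The polygon
of `S j` is glued by its base on the side `j` of the polygon of `T`.  If the side `j` is an edge
of `T`, this edge is replaced by the tree `S j`; otherwise `S j` is added and one edge
of the path of `S j` between the two ends of its base is removed (`D j` is the set of
edges of `S j` to be removed). -/
def NCTree.IsComposite {n : ℕ} (T : NCTree n) (S : Fin n → Σ m : ℕ, NCTree m)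
    (R : NCTree (∑ j, (S j).1)) : Prop :=
  ∃ D : (j : Fin n) → Set (Fin ((S j).1 + 1) × Fin ((S j).1 + 1)),
    (∀ j, (T.Edge j.castSucc j.succ → D j = ∅) ∧
      (¬ T.Edge j.castSucc j.succ → ∃ c d, (S j).2.IsOuter c d ∧ D j = {(c, d)})) ∧
    ∀ x y, R.Edge x y ↔
      (∃ a b, T.Edge a b ∧ b.val ≠ a.val + 1 ∧
        x.val = offset (fun j => (S j).1) a ∧ y.val = offset (fun j => (S j).1) b) ∨
      (∃ j c d, (S j).2.Edge c d ∧ (c, d) ∉ D j ∧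
        x.val = offset (fun j => (S j).1) j + c ∧ y.val = offset (fun j => (S j).1) j + d)

open scoped Classical in
/-- The operadic composite of `T` with `S 0, …, S (n - 1)`, that is, the result of the `n`-ary
operation `T` of the free algebra on one generator at the basis elements `S 0, …, S (n - 1)`. -/
noncomputable def NCTree.composite (K : Type*) [CommRing K] {n : ℕ} (T : NCTree n)
    (S : Fin n → Σ m : ℕ, NCTree m) : FreeNCT K :=
  ∑ R : NCTree (∑ j, (S j).1) with T.IsComposite S R, R.basis K

end FreeNCT

section FQSym

/-- The algebra of free quasi-symmetric functions, with its basis `F_σ` indexed by all the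
permutations. -/
abbrev FQSym (K : Type*) [CommRing K] : Type _ := (Σ n : ℕ, Equiv.Perm (Fin n)) →₀ K

/-- The basis element `F_σ`. -/
noncomputable def FQSym.F (K : Type*) [CommRing K] {n : ℕ} (σ : Equiv.Perm (Fin n)) : FQSym K :=
  Finsupp.single ⟨n, σ⟩ 1

/-- The word `μ` is a shuffle of the word `σ` and of the word `τ` shifted by `m`: the letters
less than `m`, and the letters at least `m`, appear in `μ` in the order prescribed by `σ`
and by the shifted `τ`. -/
def IsShiftedShuffle {m n : ℕ} (σ : Equiv.Perm (Fin m)) (τ : Equiv.Perm (Fin n))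
    (μ : Equiv.Perm (Fin (m + n))) : Prop :=
  (∀ i j : Fin m, μ.symm (Fin.castAdd n i) < μ.symm (Fin.castAdd n j) ↔ σ.symm i < σ.symm j) ∧
  (∀ i j : Fin n, μ.symm (Fin.natAdd m i) < μ.symm (Fin.natAdd m j) ↔ τ.symm i < τ.symm j)

open scoped Classical in
/-- The half-product `≺` of `FQSym`: the sum of the shifted shuffles whose last letter comes from
the first word. -/
noncomputable def FQSym.prec (K : Type*) [CommRing K] : FQSym K →ₗ[K] FQSym K →ₗ[K] FQSym K :=
  Finsupp.linearCombination K fun s => Finsupp.linearCombination K fun t =>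
    ∑ μ : Equiv.Perm (Fin (s.1 + t.1)) with IsShiftedShuffle s.2 t.2 μ ∧
      ∃ i : Fin s.1, ∀ k, μ.symm k ≤ μ.symm (Fin.castAdd t.1 i), FQSym.F K μ

open scoped Classical in
/-- The half-product `≻` of `FQSym`: the sum of the shifted shuffles whose last letter comes from
the second word. -/
noncomputable def FQSym.succ (K : Type*) [CommRing K] : FQSym K →ₗ[K] FQSym K →ₗ[K] FQSym K :=
  Finsupp.linearCombination K fun s => Finsupp.linearCombination K fun t =>
    ∑ μ : Equiv.Perm (Fin (s.1 + t.1)) with IsShiftedShuffle s.2 t.2 μ ∧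
      ∃ i : Fin t.1, ∀ k, μ.symm k ≤ μ.symm (Fin.natAdd s.1 i), FQSym.F K μ

/-- The free dendriform algebra on one generator, realized in `FQSym` as the dendriform subalgebra
generated by `F_1`. -/
noncomputable def PBT (K : Type*) [CommRing K] : Submodule K (FQSym K) :=
  sInf {A | FQSym.F K (1 : Equiv.Perm (Fin 1)) ∈ A ∧
    ∀ x ∈ A, ∀ y ∈ A, FQSym.prec K x y ∈ A ∧ FQSym.succ K x y ∈ A}

/-- `θ` is the morphism from the free algebra on one generator over the operad of non-crossing
trees to the free dendriform algebra on one generator `PBT`.  A dendriform algebra is an algebra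
over the operad of non-crossing trees, the trees `star 2`, `star 0` and `star 1`, which generate
this operad, acting by `≺`, `≻` and the associative product `≺ + ≻`.  So a morphism is
a linear map compatible with these three bilinear operations; this one
sends the generator to the generator. -/
structure IsNCTMorphism {K : Type*} [CommRing K] (θ : FreeNCT K →ₗ[K] PBT K) : Prop where
  map_generator : (θ (NCTree.unit.basis K) : FQSym K) = FQSym.F K (1 : Equiv.Perm (Fin 1))
  map_prec : ∀ {m n : ℕ} (S : NCTree m) (S' : NCTree n),
    (θ ((NCTree.star 2).composite K ![⟨m, S⟩, ⟨n, S'⟩]) : FQSym K) =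
      FQSym.prec K (θ (S.basis K)) (θ (S'.basis K))
  map_succ : ∀ {m n : ℕ} (S : NCTree m) (S' : NCTree n),
    (θ ((NCTree.star 0).composite K ![⟨m, S⟩, ⟨n, S'⟩]) : FQSym K) =
      FQSym.succ K (θ (S.basis K)) (θ (S'.basis K))
  map_mul : ∀ {m n : ℕ} (S : NCTree m) (S' : NCTree n),
    (θ ((NCTree.star 1).composite K ![⟨m, S⟩, ⟨n, S'⟩]) : FQSym K) =
      FQSym.prec K (θ (S.basis K)) (θ (S'.basis K)) +
        FQSym.succ K (θ (S.basis K)) (θ (S'.basis K))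

end FQSym

section BinaryTrees

/-- The decreasing tree of the word `w` (with distinct letters) has the shape `t`: the root
carries the largest letter `a` of `w = u a v`, and its left and right subtrees are the
decreasing trees of `u` and `v`. -/
def HasDecreasingShape (w : List ℕ) : BinaryTree Unit → Prop
  | .nil => w = []
  | .node _ l r => ∃ u a v, w = u ++ a :: v ∧ (∀ b ∈ u, b < a) ∧ (∀ b ∈ v, b < a) ∧
      HasDecreasingShape u l ∧ HasDecreasingShape v r

open scoped Classical in
/-- The natural basis of `PBT`: `P_t` is the sum of the `F_σ` such that the decreasing tree of the
inverse of `σ` has the shape `t`. -/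
noncomputable def PBT.P (K : Type*) [CommRing K] (t : BinaryTree Unit) : FQSym K :=
  ∑ σ : Equiv.Perm (Fin t.numNodes) with
    HasDecreasingShape (List.ofFn fun k => (σ.symm k : ℕ)) t, FQSym.F K σ

/-- A right rotation at some node of a binary tree. -/
inductive TamariRotation : BinaryTree Unit → BinaryTree Unit → Prop
  | rotate (a b c : BinaryTree Unit) :
      TamariRotation (.node () (.node () a b) c) (.node () a (.node () b c))
  | left {l l' : BinaryTree Unit} (r : BinaryTree Unit) :
      TamariRotation l l' → TamariRotation (.node () l r) (.node () l' r)
  | right (l : BinaryTree Unit) {r r' : BinaryTree Unit} :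
      TamariRotation r r' → TamariRotation (.node () l r) (.node () l r')

/-- The Tamari order: the reflexive and transitive closure of right rotation. -/
def TamariLE : BinaryTree Unit → BinaryTree Unit → Prop := Relation.ReflTransGen TamariRotation

/-- `I` is a (non-empty, closed) interval of the Tamari order on binary trees with `n` nodes. -/
def IsTamariInterval (n : ℕ) (I : Finset (BinaryTree Unit)) : Prop :=
  ∃ s s' : BinaryTree Unit, s.numNodes = n ∧ s'.numNodes = n ∧ TamariLE s s' ∧
    ∀ t, t ∈ I ↔ TamariLE s t ∧ TamariLE t s'

end BinaryTrees

/-!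
The proof rests on a dictionary between non-crossing trees and non-interleaving forests. The edges
of a non-crossing tree above a given side are nested, so each side has an innermost edge, and the
poset of the tree says which sides lie below the innermost edge of which side. Connectedness makes
this numbering injective (`NCTree.Lab.injective`), and a count makes it surjective
(`NCTree.E.exists_lab`). Hence the poset is a non-interleaving forest, the edges of the tree are
exactly its principal down-sets read as intervals (`NCTree.e_iff_isSpan`), and every
non-interleaving forest on a non-empty set arises from exactly one tree
(`NCTree.posetLE_injective`, `NCTree.exists_posetLE_eq`).

Through this dictionary, composing a tree with two edges with `S` and `S'` means forming the
disjoint union of the two forests and, for `star 2` (resp. `star 0`), summing over the ways of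
putting everything below one maximal element of the left (resp. right) forest. For the linear
extensions, this maximal element is the last letter. So the map sending `T` to the sum of the
`F_σ` over the linear extensions `σ` of its poset turns these composites into `≺`, `≻` and `≺ + ≻`
(`sum_linExtSum_addTop`, `sum_shuffle`). By `NCTree.basis_mem_of_composite_mem`, the trees with
two edges generate all the trees; this shows that the map takes its values in `PBT`, and that a
morphism is determined by its value at the generator.

For the Tamari order, let `t` be the decreasing tree of the inverse of `σ`. A node `i` is an
ancestor of `j` in `t` iff its letter is the largest of those between `i` and `j`. Since the
down-sets of a non-interleaving forest are intervals, `σ` is a linear extension iff the ancestor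
relation of `t` contains the forest (`isLinearExtension_iff_anc`). Prescribing right descendants
of the nodes cuts out a principal up-set of the Tamari order (`exists_least_tree`), prescribing
left descendants cuts out a principal down-set by symmetry, and both together give an interval.
-/

/-! ### Binary trees: ancestors and the Tamari order -/

theorem TamariLE.node_left {l l' : BinaryTree Unit} (h : TamariLE l l') (r : BinaryTree Unit) :
    TamariLE (.node () l r) (.node () l' r) :=
  Relation.ReflTransGen.lift (fun x => BinaryTree.node () x r) (fun _ _ => .left r) _ _ h

theorem TamariLE.node_right (l : BinaryTree Unit) {r r' : BinaryTree Unit} (h : TamariLE r r') :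
    TamariLE (.node () l r) (.node () l r') :=
  Relation.ReflTransGen.lift (fun x => BinaryTree.node () l x) (fun _ _ => .right l) _ _ h

namespace BinaryTree

/-- The nodes of a binary tree being numbered from `0` in infix order, `t.Anc i j` says that the
node `i` is equal to the node `j` or is an ancestor of it. -/
def Anc : BinaryTree Unit → ℕ → ℕ → Prop
  | .nil, _, _ => False
  | .node _ l r, i, j => (i < l.numNodes ∧ j < l.numNodes ∧ Anc l i j) ∨
      (i = l.numNodes ∧ j ≤ l.numNodes + r.numNodes) ∨
      ∃ i' j', i = l.numNodes + 1 + i' ∧ j = l.numNodes + 1 + j' ∧ Anc r i' j'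

theorem Anc.lt {t : BinaryTree Unit} {i j : ℕ} (h : t.Anc i j) :
    i < t.numNodes ∧ j < t.numNodes := by
  induction t generalizing i j with
  | nil => exact h.elim
  | node _ l r _ ihr =>
    simp only [numNodes]
    rcases h with ⟨h1, h2, _⟩ | ⟨h1, h2⟩ | ⟨i', j', rfl, rfl, h⟩
    · omega
    · omega
    · have := ihr h
      omega

theorem anc_node_left {l r : BinaryTree Unit} {i j : ℕ} (hi : i < l.numNodes) :
    (node () l r).Anc i j ↔ j < l.numNodes ∧ l.Anc i j := by
  constructor
  · rintro (⟨_, h⟩ | ⟨h, _⟩ | ⟨i', j', h, _⟩)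
    · exact h
    · omega
    · omega
  · exact fun h => .inl ⟨hi, h⟩

theorem anc_node_root {l r : BinaryTree Unit} {j : ℕ} :
    (node () l r).Anc l.numNodes j ↔ j ≤ l.numNodes + r.numNodes := by
  constructor
  · rintro (⟨h, _⟩ | ⟨_, h⟩ | ⟨i', j', h, _⟩)
    · omega
    · exact h
    · omega
  · exact fun h => .inr (.inl ⟨rfl, h⟩)

theorem anc_node_right {l r : BinaryTree Unit} {i j : ℕ} :
    (node () l r).Anc (l.numNodes + 1 + i) j ↔ ∃ j', j = l.numNodes + 1 + j' ∧ r.Anc i j' := by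
  constructor
  · rintro (⟨h, _⟩ | ⟨h, _⟩ | ⟨i', j', h, h', ha⟩)
    · omega
    · omega
    · obtain rfl : i = i' := by omega
      exact ⟨j', h', ha⟩
  · rintro ⟨j', h, h'⟩
    exact .inr (.inr ⟨i, j', rfl, h, h'⟩)

/-- The mirror image of a binary tree. -/
def mirror : BinaryTree Unit → BinaryTree Unit
  | .nil => .nil
  | .node _ l r => .node () r.mirror l.mirror

@[simp] theorem mirror_mirror (t : BinaryTree Unit) : t.mirror.mirror = t := by
  induction t with
  | nil => rfl
  | node _ l r ihl ihr => simp [mirror, ihl, ihr]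

@[simp] theorem numNodes_mirror (t : BinaryTree Unit) : t.mirror.numNodes = t.numNodes := by
  induction t with
  | nil => rfl
  | node _ l r ihl ihr => simp [mirror, ihl, ihr, add_comm]

theorem Anc.mirror {t : BinaryTree Unit} {i j i' j' : ℕ} (h : t.Anc i j)
    (hi : i + i' + 1 = t.numNodes) (hj : j + j' + 1 = t.numNodes) : t.mirror.Anc i' j' := by
  induction t generalizing i j i' j' with
  | nil => exact h.elim
  | node _ l r ihl ihr =>
    simp only [numNodes] at hi hj
    rcases h with ⟨h1, h2, h⟩ | ⟨h1, h2⟩ | ⟨p, q, rfl, rfl, h⟩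
    · refine .inr (.inr ⟨l.numNodes - 1 - i, l.numNodes - 1 - j, ?_, ?_,
        ihl h (by omega) (by omega)⟩) <;> simp only [numNodes_mirror] <;> omega
    · refine .inr (.inl ⟨?_, ?_⟩) <;> simp only [numNodes_mirror] <;> omega
    · have := h.lt
      refine .inl ⟨?_, ?_, ihr h (by omega) (by omega)⟩ <;> simp only [numNodes_mirror] <;> omega

end BinaryTree

open BinaryTree

theorem TamariRotation.mirror {t t' : BinaryTree Unit} (h : TamariRotation t t') :
    TamariRotation t'.mirror t.mirror := by
  induction h with
  | rotate a b c => exact .rotate _ _ _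
  | left r _ ih => exact .right _ ih
  | right l _ ih => exact .left _ ih

theorem TamariLE.mirror {t t' : BinaryTree Unit} (h : TamariLE t t') :
    TamariLE t'.mirror t.mirror := by
  induction h with
  | refl => exact .refl
  | tail _ h ih => exact .head h.mirror ih

theorem TamariRotation.numNodes_eq {t t' : BinaryTree Unit} (h : TamariRotation t t') :
    t.numNodes = t'.numNodes := by
  induction h with
  | rotate a b c => simp only [numNodes]; omega
  | left r _ ih => simp only [numNodes]; omega
  | right l _ ih => simp only [numNodes]; omega

/-- A right rotation can only enlarge the right subtree of a node. -/
theorem TamariRotation.anc {t t' : BinaryTree Unit} (h : TamariRotation t t') {i j : ℕ}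
    (hij : i < j) (ha : t.Anc i j) : t'.Anc i j := by
  induction h generalizing i j with
  | rotate a b c =>
    rcases ha with ⟨h1, h2, h⟩ | ⟨h1, h2⟩ | ⟨p, q, rfl, rfl, h⟩
    · simp only [numNodes] at h1 h2
      rcases h with ⟨h3, h4, h⟩ | ⟨h3, h4⟩ | ⟨p, q, rfl, rfl, h⟩
      · exact .inl ⟨h3, h4, h⟩
      · exact .inr (.inl ⟨h3, by simp only [numNodes]; omega⟩)
      · have := h.lt
        exact .inr (.inr ⟨p, q, rfl, rfl, .inl ⟨this.1, this.2, h⟩⟩)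
    · simp only [numNodes] at h1 h2
      exact .inr (.inr ⟨b.numNodes, j - (a.numNodes + 1), by omega, by omega,
        .inr (.inl ⟨rfl, by omega⟩)⟩)
    · simp only [numNodes]
      exact .inr (.inr ⟨b.numNodes + 1 + p, b.numNodes + 1 + q, by omega, by omega,
        .inr (.inr ⟨p, q, rfl, rfl, h⟩)⟩)
  | left r h ih =>
    have hn := h.numNodes_eq
    rcases ha with ⟨h1, h2, h⟩ | ⟨h1, h2⟩ | ⟨p, q, rfl, rfl, h⟩
    · exact .inl ⟨by omega, by omega, ih hij h⟩
    · exact .inr (.inl ⟨by omega, by omega⟩)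
    · exact .inr (.inr ⟨p, q, by omega, by omega, h⟩)
  | right l h ih =>
    have hn := h.numNodes_eq
    rcases ha with ⟨h1, h2, h⟩ | ⟨h1, h2⟩ | ⟨p, q, rfl, rfl, h⟩
    · exact .inl ⟨h1, h2, h⟩
    · exact .inr (.inl ⟨by omega, by omega⟩)
    · exact .inr (.inr ⟨p, q, rfl, rfl, ih (by omega) h⟩)

theorem TamariLE.numNodes_eq {t t' : BinaryTree Unit} (h : TamariLE t t') :
    t.numNodes = t'.numNodes := by
  induction h with
  | refl => rfl
  | tail _ h ih => exact ih.trans h.numNodes_eq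

theorem TamariLE.anc {t t' : BinaryTree Unit} (h : TamariLE t t') {i j : ℕ}
    (hij : i < j) (ha : t.Anc i j) : t'.Anc i j := by
  induction h with
  | refl => exact ha
  | tail _ h ih => exact h.anc hij ih

/-- A node on the right branch of `t` can be brought to the root by inverse rotations, which
changes the right subtrees of the other nodes only as far as this is forced. -/
theorem exists_node_tamariLE {t : BinaryTree Unit} {p : ℕ} (hpt : p < t.numNodes)
    (hp : ∀ j, p < j → j < t.numNodes → t.Anc p j) :
    ∃ a c : BinaryTree Unit, TamariLE (.node () a c) t ∧ a.numNodes = p ∧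
      (∀ i j, i < j → j < p → t.Anc i j → a.Anc i j) ∧
      ∀ i j, t.Anc (p + 1 + i) (p + 1 + j) → c.Anc i j := by
  induction t generalizing p with
  | nil => simp at hpt
  | node _ l r _ ihr =>
    simp only [numNodes] at hpt hp
    rcases lt_trichotomy p l.numNodes with h | rfl | h
    · have := ((anc_node_left h).1 (hp l.numNodes h (by omega))).1
      omega
    · refine ⟨l, r, .refl, rfl, fun i j hij hj ha => ?_, fun i j ha => ?_⟩
      · exact ((anc_node_left (by omega)).1 ha).2
      · obtain ⟨j', hj', h⟩ := anc_node_right.1 ha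
        obtain rfl : j = j' := by omega
        exact h
    · obtain ⟨q, rfl⟩ : ∃ q, p = l.numNodes + 1 + q := ⟨p - l.numNodes - 1, by omega⟩
      obtain ⟨a, c, hle, ha, h1, h2⟩ := ihr (p := q) (by omega) (fun j hj hjr => by
        obtain ⟨j', hj', h⟩ := anc_node_right.1 (hp (l.numNodes + 1 + j) (by omega) (by omega))
        obtain rfl : j = j' := by omega
        exact h)
      refine ⟨.node () l a, c, .head (.rotate l a c) (hle.node_right l), ?_, ?_, ?_⟩
      · simp only [numNodes]
        omega
      · rintro i j hij hj (⟨h3, h4, h⟩ | ⟨h3, h4⟩ | ⟨i', j', rfl, rfl, h⟩)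
        · exact .inl ⟨h3, h4, h⟩
        · exact .inr (.inl ⟨h3, by omega⟩)
        · exact .inr (.inr ⟨i', j', rfl, rfl, h1 i' j' (by omega) (by omega) h⟩)
      · intro i j h
        rw [show l.numNodes + 1 + q + 1 + i = l.numNodes + 1 + (q + 1 + i) by omega,
          anc_node_right] at h
        obtain ⟨j', hj', h⟩ := h
        obtain rfl : j' = q + 1 + j := by omega
        exact h2 i j h

/-- Among the binary trees in which prescribed nodes have prescribed right descendants, there is
a least one for the Tamari order, provided that the prescription is closed under
intermediate nodes and transitive. -/
theorem exists_least_tree (n : ℕ) (D : ℕ → ℕ → Prop)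
    (interval : ∀ i k j, i < k → k < j → j < n → D i j → D i k)
    (trans : ∀ i j k, i < j → j < k → k < n → D i j → D j k → D i k) :
    ∃ s : BinaryTree Unit, s.numNodes = n ∧ (∀ i j, i < j → j < n → D i j → s.Anc i j) ∧
      ∀ t : BinaryTree Unit, t.numNodes = n → (∀ i j, i < j → j < n → D i j → t.Anc i j) →
        TamariLE s t := by
  classical
  induction n using Nat.strong_induction_on generalizing D with
  | _ n ih =>
  rcases Nat.eq_zero_or_pos n with rfl | hn
  · refine ⟨.nil, rfl, fun i j _ h => by omega, fun t ht _ => ?_⟩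
    cases t with
    | nil => exact .refl
    | node _ l r => simp at ht
  -- The root is the first node which must have all the following nodes as descendants.
  have hex : ∃ p, p < n ∧ ∀ j, p < j → j < n → D p j := ⟨n - 1, by omega, fun j _ _ => by omega⟩
  obtain ⟨hpn, hp⟩ := Nat.find_spec hex
  have hmin : ∀ i, i < Nat.find hex → ¬ (i < n ∧ ∀ j, i < j → j < n → D i j) :=
    fun i => Nat.find_min hex
  generalize Nat.find hex = p at hpn hp hmin
  have hsep : ∀ i j, i < p → p ≤ j → j < n → ¬ D i j := by
    intro i j hi hj hjn hD
    have hip : D i p := by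
      rcases hj.eq_or_lt with rfl | h
      · exact hD
      · exact interval i p j hi h hjn hD
    refine hmin i hi ⟨by omega, fun k hk hkn => ?_⟩
    rcases lt_trichotomy k p with h | rfl | h
    · exact interval i k p hk h hpn hip
    · exact hip
    · exact trans i p k hi h hkn hip (hp k h hkn)
  obtain ⟨s₁, hn₁, hs₁, hl₁⟩ := ih p hpn D (fun i k j h1 h2 h3 => interval i k j h1 h2 (by omega))
    (fun i j k h1 h2 h3 => trans i j k h1 h2 (by omega))
  obtain ⟨s₂, hn₂, hs₂, hl₂⟩ := ih (n - p - 1) (by omega) (fun i j => D (p + 1 + i) (p + 1 + j))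
    (fun i k j h1 h2 h3 => interval _ _ _ (by omega) (by omega) (by omega))
    (fun i j k h1 h2 h3 => trans _ _ _ (by omega) (by omega) (by omega))
  refine ⟨.node () s₁ s₂, by simp only [numNodes]; omega, fun i j hij hj hD => ?_,
    fun t ht htD => ?_⟩
  · rcases lt_trichotomy i p with h | rfl | h
    · have hjp : j < p := by
        by_contra hjp
        exact hsep i j h (by omega) hj hD
      exact .inl ⟨by omega, by omega, hs₁ i j hij hjp hD⟩
    · exact .inr (.inl ⟨hn₁.symm, by omega⟩)
    · obtain ⟨i', rfl⟩ : ∃ i', i = p + 1 + i' := ⟨i - p - 1, by omega⟩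
      obtain ⟨j', rfl⟩ : ∃ j', j = p + 1 + j' := ⟨j - p - 1, by omega⟩
      exact .inr (.inr ⟨i', j', by omega, by omega, hs₂ i' j' (by omega) (by omega) hD⟩)
  · obtain ⟨a, c, hle, ha, h1, h2⟩ := exists_node_tamariLE (t := t) (p := p) (by omega)
      (fun j hj hjt => htD p j hj (by omega) (hp j hj (by omega)))
    have hc := hle.numNodes_eq
    simp only [numNodes] at hc
    refine Relation.ReflTransGen.trans ?_ hle
    refine Relation.ReflTransGen.trans
      ((hl₁ a ha fun i j hij hj hD => h1 i j hij hj (htD i j hij (by omega) hD)).node_left s₂)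
      (TamariLE.node_right a (hl₂ c (by omega) fun i j hij hj hD =>
        h2 i j (htD _ _ (by omega) (by omega) hD)))

/-- The ancestor relation of the trees `t` with `n` nodes extends a given relation `D` for the
`t` of an interval of the Tamari order, provided that `D` is transitive and
closed under intermediate nodes, and that there is such a tree `t`. -/
theorem isTamariInterval_of_anc {n : ℕ} {D : ℕ → ℕ → Prop} {I : Finset (BinaryTree Unit)}
    (hI : ∀ t, t ∈ I ↔ t.numNodes = n ∧ ∀ i j, i < n → j < n → D i j → t.Anc i j)
    (interval : ∀ i j k, D i j → k ∈ Set.uIcc i j → D i k)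
    (trans : ∀ i j k, D i j → D j k → D i k) (hne : I.Nonempty) : IsTamariInterval n I := by
  obtain ⟨s, hsn, hs, hsl⟩ := exists_least_tree n D
    (fun i k j h1 h2 _ h => interval i j k h (Set.mem_uIcc.2 (.inl ⟨h1.le, h2.le⟩)))
    (fun i j k _ _ _ => trans i j k)
  obtain ⟨s', hsn', hs', hsl'⟩ := exists_least_tree n (fun i j => D (n - 1 - i) (n - 1 - j))
    (fun i k j h1 h2 h3 h => interval _ _ _ h (Set.mem_uIcc.2 (.inr ⟨by omega, by omega⟩)))
    (fun i j k _ _ _ => trans _ _ _)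
  have anc_self : ∀ (t : BinaryTree Unit) (i : ℕ), i < t.numNodes → t.Anc i i := by
    intro t
    induction t with
    | nil => intro i hi; simp at hi
    | node _ l r ihl ihr =>
      intro i hi
      simp only [numNodes] at hi
      rcases lt_trichotomy i l.numNodes with h | h | h
      · exact .inl ⟨h, h, ihl i h⟩
      · exact .inr (.inl ⟨h, by omega⟩)
      · exact .inr (.inr ⟨i - l.numNodes - 1, i - l.numNodes - 1, by omega, by omega,
          ihr _ (by omega)⟩)
  have key : ∀ t, t ∈ I ↔ TamariLE s t ∧ TamariLE t s'.mirror := by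
    intro t
    rw [hI]
    constructor
    · rintro ⟨htn, ht⟩
      refine ⟨hsl t htn fun i j hij hj h => ht i j (by omega) hj h, ?_⟩
      have h := hsl' t.mirror (by simpa using htn) fun i j hij hj h =>
        (ht _ _ (by omega) (by omega) h).mirror (by omega) (by omega)
      simpa using h.mirror
    · rintro ⟨h1, h2⟩
      have htn := h1.numNodes_eq
      refine ⟨by omega, fun i j hi hj h => ?_⟩
      rcases lt_trichotomy i j with hij | rfl | hij
      · exact h1.anc hij (hs i j hij hj h)
      · exact anc_self t i (by omega)
      · have h3 := h2.mirror
        rw [mirror_mirror] at h3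
        have h4 := h3.anc (i := n - 1 - i) (j := n - 1 - j) (by omega)
          (hs' _ _ (by omega) (by omega) (by
            rw [show n - 1 - (n - 1 - i) = i by omega, show n - 1 - (n - 1 - j) = j by omega]
            exact h))
        rw [← mirror_mirror t]
        exact h4.mirror (by rw [numNodes_mirror]; omega) (by rw [numNodes_mirror]; omega)
  obtain ⟨t, ht⟩ := hne
  exact ⟨s, s'.mirror, hsn, by simpa using hsn', ((key t).1 ht).1.trans ((key t).1 ht).2, key⟩

/-! ### Decreasing trees of words -/

theorem HasDecreasingShape.numNodes_eq {w : List ℕ} {t : BinaryTree Unit}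
    (h : HasDecreasingShape w t) : t.numNodes = w.length := by
  induction t generalizing w with
  | nil =>
    obtain rfl : w = [] := h
    rfl
  | node _ l r ihl ihr =>
    obtain ⟨u, a, v, rfl, _, _, hl, hr⟩ := h
    simp [ihl hl, ihr hr]
    omega

theorem HasDecreasingShape.unique {w : List ℕ} {t t' : BinaryTree Unit}
    (h : HasDecreasingShape w t) (h' : HasDecreasingShape w t') : t = t' := by
  induction t generalizing w t' with
  | nil =>
    obtain rfl : w = [] := h
    cases t' with
    | nil => rfl
    | node _ l r => obtain ⟨u, a, v, hw, _⟩ := h'; simp at hw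
  | node _ l r ihl ihr =>
    obtain ⟨u, a, v, rfl, hu, hv, hl, hr⟩ := h
    cases t' with
    | nil => exact absurd (show u ++ a :: v = [] from h') (by simp)
    | node _ l' r' =>
      obtain ⟨u', a', v', hw, hu', hv', hl', hr'⟩ := h'
      have : u = u' ∧ a = a' ∧ v = v' := by
        rcases List.append_eq_append_iff.1 hw with ⟨c, rfl, hc⟩ | ⟨c, rfl, hc⟩
        · cases c with
          | nil => simpa using hc
          | cons x c =>
            simp only [List.cons_append, List.cons.injEq] at hc
            obtain ⟨rfl, rfl⟩ := hc
            have h1 := hu' a (by simp)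
            have h2 := hv a' (by simp)
            omega
        · cases c with
          | nil => simpa [eq_comm] using hc
          | cons x c =>
            simp only [List.cons_append, List.cons.injEq] at hc
            obtain ⟨rfl, rfl⟩ := hc
            have h1 := hu a' (by simp)
            have h2 := hv' a (by simp)
            omega
      obtain ⟨rfl, rfl, rfl⟩ := this
      rw [ihl hl hl', ihr hr hr']

theorem exists_hasDecreasingShape (w : List ℕ) (hw : w.Nodup) : ∃ t, HasDecreasingShape w t := by
  induction hn : w.length using Nat.strong_induction_on generalizing w with
  | _ n ih =>
  rcases eq_or_ne w [] with rfl | hne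
  · exact ⟨.nil, rfl⟩
  obtain ⟨a, ha, hmax⟩ := w.toFinset.exists_max_image id ⟨w.head hne, by simp⟩
  obtain ⟨u, v, rfl⟩ := List.append_of_mem (List.mem_toFinset.1 ha)
  rw [List.nodup_middle, List.nodup_cons, List.mem_append] at hw
  obtain ⟨t₁, h₁⟩ := ih u.length (by simp at hn; omega) u (hw.2.sublist (by simp)) rfl
  obtain ⟨t₂, h₂⟩ := ih v.length (by simp at hn; omega) v (hw.2.sublist (by simp)) rfl
  refine ⟨.node () t₁ t₂, u, a, v, rfl, fun b hb => ?_, fun b hb => ?_, h₁, h₂⟩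
  · refine lt_of_le_of_ne (hmax b (by simp [hb])) ?_
    rintro rfl
    exact hw.1 (.inl hb)
  · refine lt_of_le_of_ne (hmax b (by simp [hb])) ?_
    rintro rfl
    exact hw.1 (.inr hb)

/-- In the decreasing tree of a word, a node is an ancestor of another one iff its letter is the
largest one of the factor between them. -/
theorem HasDecreasingShape.anc_iff {w : List ℕ} {t : BinaryTree Unit}
    (h : HasDecreasingShape w t) (i j : ℕ) :
    t.Anc i j ↔ i < w.length ∧ j < w.length ∧ ∀ k ∈ Set.uIcc i j, w.getD k 0 ≤ w.getD i 0 := by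
  induction t generalizing w i j with
  | nil =>
    obtain rfl : w = [] := h
    simp [Anc]
  | node _ l r ihl ihr =>
    obtain ⟨u, a, v, rfl, hu, hv, hl, hr⟩ := h
    have hul := hl.numNodes_eq
    have hvr := hr.numNodes_eq
    have g1 : ∀ k, k < u.length → (u ++ a :: v).getD k 0 = u.getD k 0 := fun k hk =>
      List.getD_append _ _ _ _ hk
    have g1' : ∀ k, k < u.length → u.getD k 0 < a := fun k hk => by
      rw [List.getD_eq_getElem _ _ hk]
      exact hu _ (List.getElem_mem hk)
    have g2 : (u ++ a :: v).getD u.length 0 = a := by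
      rw [List.getD_append_right _ _ _ _ le_rfl]; simp
    have g3 : ∀ k, (u ++ a :: v).getD (u.length + 1 + k) 0 = v.getD k 0 := fun k => by
      rw [List.getD_append_right _ _ _ _ (by omega),
        show u.length + 1 + k - u.length = k + 1 by omega]
      simp
    have g3' : ∀ k, k < v.length → v.getD k 0 < a := fun k hk => by
      rw [List.getD_eq_getElem _ _ hk]
      exact hv _ (List.getElem_mem hk)
    have hlen : (u ++ a :: v).length = u.length + 1 + v.length := by
      simp; omega
    rw [hlen]
    generalize (u ++ a :: v).getD = g at g1 g2 g3
    simp only [Set.mem_uIcc]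
    rcases lt_trichotomy i u.length with hi | rfl | hi
    · rw [anc_node_left (by omega), ihl hl]
      simp only [Set.mem_uIcc]
      constructor
      · rintro ⟨h1, _, _, h2⟩
        refine ⟨by omega, by omega, fun k hk => ?_⟩
        rw [g1 i hi, g1 k (by omega)]
        exact h2 k hk
      · rintro ⟨_, h1, h2⟩
        have hj : j < u.length := by
          by_contra hj
          have h3 := h2 u.length (by omega)
          have h4 := g1' i hi
          rw [g2, g1 i hi] at h3
          omega
        refine ⟨by omega, hi, hj, fun k hk => ?_⟩
        have h3 := h2 k hk
        rwa [g1 i hi, g1 k (by omega)] at h3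
    · rw [← hul, anc_node_root, hul]
      constructor
      · intro h1
        refine ⟨by omega, by omega, fun k hk => ?_⟩
        rw [g2]
        rcases lt_trichotomy k u.length with hk' | rfl | hk'
        · rw [g1 k hk']
          exact (g1' k hk').le
        · exact g2.le
        · obtain ⟨k', rfl⟩ : ∃ k', k = u.length + 1 + k' := ⟨k - u.length - 1, by omega⟩
          rw [g3]
          exact (g3' k' (by omega)).le
      · rintro ⟨_, h1, _⟩
        omega
    · obtain ⟨i', rfl⟩ : ∃ i', i = u.length + 1 + i' := ⟨i - u.length - 1, by omega⟩
      rw [← hul, anc_node_right, hul]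
      constructor
      · rintro ⟨j', rfl, h1⟩
        obtain ⟨h1, h2, h3⟩ := (ihr hr _ _).1 h1
        refine ⟨by omega, by omega, fun k hk => ?_⟩
        obtain ⟨k', rfl⟩ : ∃ k', k = u.length + 1 + k' := ⟨k - u.length - 1, by omega⟩
        rw [g3, g3]
        exact h3 k' (Set.mem_uIcc.2 (by omega))
      · rintro ⟨h0, h1, h2⟩
        have hj : u.length < j := by
          by_contra hj
          have h3 := h2 u.length (by omega)
          have h4 := g3' i' (by omega)
          rw [g2, g3] at h3
          omega
        refine ⟨j - u.length - 1, by omega, (ihr hr _ _).2 ⟨by omega, by omega, fun k hk => ?_⟩⟩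
        have h3 := h2 (u.length + 1 + k) (by rw [Set.mem_uIcc] at hk; omega)
        rwa [g3, g3] at h3

/-! ### Non-crossing trees as non-interleaving forests -/

/-- The descendants of `i` for the relation `r` are the `j` with `a ≤ j < b`. -/
def IsSpan {n : ℕ} (r : Fin n → Fin n → Prop) (i : Fin n) (a b : ℕ) : Prop :=
  b ≤ n ∧ ∀ j : Fin n, r j i ↔ a ≤ j ∧ j < b

theorem IsSpan.unique {n : ℕ} {r : Fin n → Fin n → Prop} {i : Fin n} {a b c d : ℕ}
    (hi : r i i) (h : IsSpan r i a b) (h' : IsSpan r i c d) : a = c ∧ b = d := by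
  have h1 := (h.2 i).1 hi
  have h2 := (h'.2 i).1 hi
  have hb := h.1
  have hd := h'.1
  have key : ∀ x (hx : x < n), (a ≤ x ∧ x < b) ↔ (c ≤ x ∧ x < d) := fun x hx =>
    (h.2 ⟨x, hx⟩).symm.trans (h'.2 ⟨x, hx⟩)
  have k1 := key a (by omega)
  have k2 := key c (by omega)
  have k3 := key (b - 1) (by omega)
  have k4 := key (d - 1) (by omega)
  omega

theorem IsNonInterleavingForest.exists_isSpan {n : ℕ} {r : Fin n → Fin n → Prop}
    (hr : IsNonInterleavingForest r) (i : Fin n) : ∃ a b, IsSpan r i a b := by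
  classical
  have hi : i ∈ Finset.univ.filter (fun j => r j i) := by simp [hr.refl i]
  obtain ⟨a, ha, hamin⟩ := (Finset.univ.filter (fun j => r j i)).exists_min_image id ⟨i, hi⟩
  obtain ⟨b, hb, hbmax⟩ := (Finset.univ.filter (fun j => r j i)).exists_max_image id ⟨i, hi⟩
  simp only [Finset.mem_filter, Finset.mem_univ, true_and, id] at ha hb hamin hbmax
  refine ⟨a, b + 1, by omega, fun j => ⟨fun h => ⟨hamin j h, ?_⟩, fun h => ?_⟩⟩
  · exact Nat.lt_succ_of_le (hbmax j h)
  · exact (hr.interval i).out ha hb ⟨h.1, Nat.le_of_lt_succ h.2⟩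

theorem SimpleGraph.card_edgeSet_eq {V : Type*} [LinearOrder V] (G : SimpleGraph V) :
    Nat.card G.edgeSet = Nat.card {p : V × V // p.1 < p.2 ∧ G.Adj p.1 p.2} := by
  symm
  refine Nat.card_congr (Equiv.ofBijective (fun p => ⟨s(p.1.1, p.1.2), p.2.2⟩) ⟨?_, ?_⟩)
  · rintro ⟨⟨a, b⟩, hab, _⟩ ⟨⟨c, d⟩, hcd, _⟩ h
    rcases Sym2.eq_iff.1 (congrArg Subtype.val h) with ⟨h1, h2⟩ | ⟨h1, h2⟩ <;>
      simp only at h1 h2 hab hcd <;> subst h1 <;> subst h2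
    · rfl
    · exact absurd hab hcd.asymm
  · rintro ⟨e, he⟩
    induction e with
    | _ a b =>
    rcases (G.ne_of_adj he).lt_or_gt with h | h
    · exact ⟨⟨(a, b), h, he⟩, rfl⟩
    · exact ⟨⟨(b, a), h, G.adj_symm he⟩, Subtype.ext Sym2.eq_swap⟩

namespace NCTree

variable {n : ℕ}

/-- `{a, b}`, with `a < b`, is an edge of `T`, the vertices being natural numbers. -/
def E (T : NCTree n) (a b : ℕ) : Prop := ∃ x y : Fin (n + 1), T.Edge x y ∧ x.val = a ∧ y.val = b

/-- The edge `{a, b}` has the number `k`, the vertices and the sides being natural numbers. -/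
def Lab (T : NCTree n) (a b k : ℕ) : Prop :=
  T.E a b ∧ a ≤ k ∧ k < b ∧ ∀ c d, T.E c d → a ≤ c → d ≤ b → c ≤ k → k < d → c = a ∧ d = b

theorem E.lt {T : NCTree n} {a b : ℕ} (h : T.E a b) : a < b := by
  obtain ⟨x, y, h, rfl, rfl⟩ := h
  exact h.1

theorem E.le {T : NCTree n} {a b : ℕ} (h : T.E a b) : b ≤ n := by
  obtain ⟨x, y, h, rfl, rfl⟩ := h
  omega

theorem e_val_iff {T : NCTree n} {x y : Fin (n + 1)} : T.E x y ↔ T.Edge x y := by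
  constructor
  · rintro ⟨x', y', h, hx, hy⟩
    rwa [← Fin.ext hx, ← Fin.ext hy]
  · exact fun h => ⟨x, y, h, rfl, rfl⟩

theorem not_e_of_crossing {T : NCTree n} {a b c d : ℕ} (h : T.E a c) (h' : T.E b d)
    (hab : a < b) (hbc : b < c) (hcd : c < d) : False := by
  obtain ⟨x, z, h, rfl, rfl⟩ := h
  obtain ⟨y, w, h', rfl, rfl⟩ := h'
  exact T.noncrossing x y z w hab hbc hcd h.2 h'.2

theorem eq_of_e_iff {T T' : NCTree n} (h : ∀ a b, T.E a b ↔ T'.E a b) : T = T' := by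
  apply graph_injective
  ext x y
  have key : ∀ x y : Fin (n + 1), x < y → (T.graph.Adj x y ↔ T'.graph.Adj x y) := by
    intro x y hxy
    have h1 := h x y
    rw [e_val_iff, e_val_iff] at h1
    exact ⟨fun h2 => (h1.1 ⟨hxy, h2⟩).2, fun h2 => (h1.2 ⟨hxy, h2⟩).2⟩
  rcases lt_trichotomy x y with h1 | rfl | h1
  · exact key x y h1
  · simp
  · rw [T.graph.adj_comm, T'.graph.adj_comm]
    exact key y x h1

/-- The tree being connected, an edge leaves every proper part of its vertices. -/
theorem exists_e_of_cut (T : NCTree n) (p : ℕ → Prop) {u v : ℕ} (hu : u ≤ n) (hv : v ≤ n)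
    (hpu : p u) (hpv : ¬ p v) : ∃ a b, T.E a b ∧ ¬ (p a ↔ p b) := by
  by_contra! hcon
  have hreach := (SimpleGraph.reachable_iff_reflTransGen _ _).1
    (T.isTree.connected.preconnected ⟨u, by omega⟩ ⟨v, by omega⟩)
  have key : ∀ w : Fin (n + 1), Relation.ReflTransGen T.graph.Adj ⟨u, by omega⟩ w → p w := by
    intro w hw
    induction hw with
    | refl => exact hpu
    | @tail y z _ hyz ih =>
      rcases (T.graph.ne_of_adj hyz).lt_or_gt with h | h
      · exact (hcon _ _ (e_val_iff.2 ⟨h, hyz⟩)).1 ih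
      · exact (hcon _ _ (e_val_iff.2 ⟨h, T.graph.adj_symm hyz⟩)).2 ih
  exact hpv (key _ hreach)

theorem exists_lab (T : NCTree n) {k : ℕ} (hk : k < n) : ∃ a b, T.Lab a b k := by
  classical
  have hex : ∃ l a b, l = b - a ∧ T.E a b ∧ a ≤ k ∧ k < b := by
    obtain ⟨a, b, h, hab⟩ := T.exists_e_of_cut (· ≤ k) (Nat.zero_le n) le_rfl (Nat.zero_le k)
      (by omega)
    have := h.lt
    exact ⟨_, a, b, rfl, h, by omega, by omega⟩
  obtain ⟨a, b, hl, h, h1, h2⟩ := Nat.find_spec hex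
  refine ⟨a, b, h, h1, h2, fun c d hcd hac hdb hck hkd => ?_⟩
  have := Nat.find_min' hex ⟨c, d, rfl, hcd, hck, hkd⟩
  omega

/-- The edges above a side form a chain, of which the edge with the number of this side is the
least. -/
theorem Lab.le_of_e {T : NCTree n} {a b c d k : ℕ} (h : T.Lab a b k) (h' : T.E c d)
    (hc : c ≤ k) (hd : k < d) : c ≤ a ∧ b ≤ d := by
  obtain ⟨h, hak, hkb, hmin⟩ := h
  have := hmin c d h'
  have h1 : ¬ (a < c ∧ b < d) := fun ⟨h1, h2⟩ => not_e_of_crossing h h' h1 (by omega) h2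
  have h2 : ¬ (c < a ∧ d < b) := fun ⟨h1, h2⟩ => not_e_of_crossing h' h h1 (by omega) h2
  omega

theorem Lab.unique {T : NCTree n} {a b c d k : ℕ} (h : T.Lab a b k) (h' : T.Lab c d k) :
    a = c ∧ b = d := by
  have h1 := h.le_of_e h'.1 h'.2.1 h'.2.2.1
  have h2 := h'.le_of_e h.1 h.2.1 h.2.2.1
  omega

/-- An edge has at most one number: the vertices between two sides with the same innermost
edge above them would be separated from the other vertices. -/
theorem Lab.injective {T : NCTree n} {a b k k' : ℕ} (h : T.Lab a b k) (h' : T.Lab a b k') :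
    k = k' := by
  have key : ∀ {k k'}, T.Lab a b k → T.Lab a b k' → ¬ k < k' := by
    intro k k' h h' hlt
    have hb := h.1.le
    have h1 := h.2
    have h2 := h'.2
    obtain ⟨c, d, hcd, hne⟩ := T.exists_e_of_cut (fun x => k < x ∧ x ≤ k') (u := k + 1) (v := k)
      (by omega) (by omega) (by omega) (by omega)
    have hlt := hcd.lt
    have h3 := h.le_of_e hcd
    have h4 := h'.le_of_e hcd
    omega
  rcases lt_trichotomy k k' with hlt | heq | hlt
  · exact absurd hlt (key h h')
  · exact heq
  · exact absurd hlt (key h' h)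

/-- Every edge has a number, as there are as many edges as sides. -/
theorem E.exists_lab {T : NCTree n} {a b : ℕ} (h : T.E a b) : ∃ k, k < n ∧ T.Lab a b k := by
  choose lo hi hlab using fun k : Fin n => T.exists_lab k.2
  let f : Fin n → {p : Fin (n + 1) × Fin (n + 1) // p.1 < p.2 ∧ T.graph.Adj p.1 p.2} := fun k =>
    ⟨(⟨lo k, by have := (hlab k).1.lt; have := (hlab k).1.le; omega⟩,
      ⟨hi k, by have := (hlab k).1.le; omega⟩), e_val_iff.1 (hlab k).1⟩
  have hf : Function.Injective f := by
    intro k k' hkk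
    have hp := congrArg Subtype.val hkk
    have h1 := hlab k
    rw [show lo k = lo k' from congrArg (fun p => p.1.val) hp,
      show hi k = hi k' from congrArg (fun p => p.2.val) hp] at h1
    exact Fin.ext (h1.injective (hlab k'))
  have hcard := (SimpleGraph.isTree_iff_connected_and_card.1 T.isTree).2
  rw [SimpleGraph.card_edgeSet_eq, Nat.card_fin] at hcard
  have hbij := hf.bijective_of_nat_card_le (by rw [Nat.card_fin]; omega)
  obtain ⟨x, y, hxy, rfl, rfl⟩ := h
  obtain ⟨k, hk⟩ := hbij.2 ⟨(x, y), hxy⟩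
  refine ⟨k, k.2, ?_⟩
  have hp := congrArg Subtype.val hk
  rw [← show lo k = x from congrArg (fun p => p.1.val) hp,
    ← show hi k = y from congrArg (fun p => p.2.val) hp]
  exact hlab k

theorem hasLabel_iff {T : NCTree n} {x y : Fin (n + 1)} {k : Fin n} :
    T.HasLabel x y k ↔ T.Lab x y k := by
  unfold HasLabel Lab
  rw [e_val_iff]
  refine and_congr_right fun hxy => and_congr Iff.rfl (and_congr Iff.rfl ⟨?_, ?_⟩)
  · rintro h c d ⟨z, w, hzw, rfl, rfl⟩ h1 h2 h3 h4
    obtain ⟨rfl, rfl⟩ := h z w hzw h1 h2 h3 h4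
    exact ⟨rfl, rfl⟩
  · intro h z w hzw h1 h2 h3 h4
    obtain ⟨h5, h6⟩ := h z w (e_val_iff.2 hzw) h1 h2 h3 h4
    exact ⟨Fin.ext h5, Fin.ext h6⟩

theorem Lab.isSpan {T : NCTree n} {a b : ℕ} {j : Fin n} (h : T.Lab a b j) :
    IsSpan T.posetLE j a b := by
  refine ⟨h.1.le, fun i => ⟨?_, ?_⟩⟩
  · rintro ⟨x, y, z, w, h1, h2, h3, h4⟩
    obtain ⟨rfl, rfl⟩ := h.unique (hasLabel_iff.1 h2)
    have h5 := hasLabel_iff.1 h1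
    exact ⟨le_trans h3 h5.2.1, lt_of_lt_of_le h5.2.2.1 h4⟩
  · rintro ⟨h1, h2⟩
    obtain ⟨c, d, hcd⟩ := T.exists_lab i.2
    have h3 := hcd.le_of_e h.1 h1 h2
    have h4 := h.1.le
    have h5 := h.1.lt
    have h6 := hcd.1.lt
    refine ⟨⟨c, by omega⟩, ⟨d, by omega⟩, ⟨a, by omega⟩, ⟨b, by omega⟩, ?_, ?_, h3.1, h3.2⟩
    · exact hasLabel_iff.2 hcd
    · exact hasLabel_iff.2 h

theorem isNonInterleavingForest_posetLE (T : NCTree n) : IsNonInterleavingForest T.posetLE := by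
  choose lo hi hlab using fun k : Fin n => T.exists_lab k.2
  have hiff : ∀ i j : Fin n, T.posetLE i j ↔ lo j ≤ i ∧ i < hi j := fun i j =>
    (hlab j).isSpan.2 i
  have nest : ∀ i j : Fin n, T.posetLE i j → lo j ≤ lo i ∧ hi i ≤ hi j := fun i j h =>
    (hlab i).le_of_e (hlab j).1 ((hiff i j).1 h).1 ((hiff i j).1 h).2
  refine ⟨fun i => (hiff i i).2 ⟨(hlab i).2.1, (hlab i).2.2.1⟩, fun i j h h' => ?_,
    fun i j k h h' => ?_, fun i j k h h' => ?_, fun i => ⟨fun j hj k hk l hl => ?_⟩⟩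
  · have h1 := nest i j h
    have h2 := nest j i h'
    have h3 := hlab i
    rw [show lo i = lo j by omega, show hi i = hi j by omega] at h3
    exact Fin.ext (h3.injective (hlab j))
  · have h1 := nest j k h'
    rw [hiff] at h ⊢
    omega
  · have h1 : ¬ (lo j < lo k ∧ hi j < hi k) := fun h1 => by
      rw [hiff] at h h'
      exact not_e_of_crossing (hlab j).1 (hlab k).1 h1.1 (by omega) h1.2
    have h2 : ¬ (lo k < lo j ∧ hi k < hi j) := fun h2 => by
      rw [hiff] at h h'
      exact not_e_of_crossing (hlab k).1 (hlab j).1 h2.1 (by omega) h2.2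
    have h3 := (hlab j).2
    have h4 := (hlab k).2
    rw [hiff, hiff]
    omega
  · have h1 := (hiff j i).1 hj
    have h2 := (hiff k i).1 hk
    have h3 : j.val ≤ l.val := hl.1
    have h4 : l.val ≤ k.val := hl.2
    exact (hiff l i).2 (by omega)

/-- The edges of a non-crossing tree are the down-sets of its poset. -/
theorem e_iff_isSpan (T : NCTree n) {a b : ℕ} : T.E a b ↔ ∃ i, IsSpan T.posetLE i a b := by
  constructor
  · intro h
    obtain ⟨k, hk, h⟩ := h.exists_lab
    exact ⟨⟨k, hk⟩, h.isSpan⟩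
  · rintro ⟨i, hi⟩
    obtain ⟨c, d, h⟩ := T.exists_lab i.2
    obtain ⟨rfl, rfl⟩ := hi.unique (T.isNonInterleavingForest_posetLE.refl i) h.isSpan
    exact h.1

theorem posetLE_injective {T T' : NCTree n} (h : T.posetLE = T'.posetLE) : T = T' :=
  eq_of_e_iff fun a b => by rw [e_iff_isSpan, e_iff_isSpan, h]

/-- Every non-interleaving forest is the poset of a non-crossing tree: an element whose
descendants are the `j` with `a ≤ j < b` gives the edge `{a, b}`. -/
theorem exists_posetLE_eq {r : Fin n → Fin n → Prop} (hr : IsNonInterleavingForest r)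
    (hn : 0 < n) : ∃ T : NCTree n, T.posetLE = r := by
  choose lo hi hspan using hr.exists_isSpan
  have hiff : ∀ i j : Fin n, r i j ↔ lo j ≤ i ∧ i < hi j := fun i j => (hspan j).2 i
  have hself : ∀ i : Fin n, lo i ≤ i ∧ i < hi i := fun i => (hiff i i).1 (hr.refl i)
  have hle : ∀ i : Fin n, hi i ≤ n := fun i => (hspan i).1
  have nest : ∀ i j : Fin n, r i j → lo j ≤ lo i ∧ hi i ≤ hi j := by
    intro i j h
    have h1 := hself i
    have h2 := hle i
    have h3 := hr.trans ⟨lo i, by omega⟩ i j ((hiff _ i).2 ⟨le_rfl, by simp only; omega⟩) h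
    have h4 := hr.trans ⟨hi i - 1, by omega⟩ i j
      ((hiff _ i).2 ⟨by simp only; omega, by simp only; omega⟩) h
    rw [hiff] at h3 h4
    simp only at h3 h4
    omega
  have inj : ∀ i j : Fin n, lo i = lo j → hi i = hi j → i = j := fun i j h1 h2 =>
    hr.antisymm i j ((hiff i j).2 (h1 ▸ h2 ▸ hself i)) ((hiff j i).2 (h1 ▸ h2 ▸ hself j))
  let G : SimpleGraph (Fin (n + 1)) :=
    { Adj := fun x y => ∃ i, (x.val = lo i ∧ y.val = hi i) ∨ (y.val = lo i ∧ x.val = hi i)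
      symm := ⟨fun x y ⟨i, h⟩ => ⟨i, h.symm⟩⟩
      loopless := ⟨fun x ⟨i, h⟩ => by have := hself i; omega⟩ }
  have adj_iff : ∀ x y : Fin (n + 1), x < y → (G.Adj x y ↔ ∃ i, x.val = lo i ∧ y.val = hi i) := by
    intro x y hxy
    have hxy : x.val < y.val := hxy
    constructor
    · rintro ⟨i, h | h⟩
      · exact ⟨i, h⟩
      · have := hself i
        omega
    · rintro ⟨i, h⟩
      exact ⟨i, .inl h⟩
  have noncrossing : ∀ a b c d : Fin (n + 1), a < b → b < c → c < d →
      G.Adj a c → ¬ G.Adj b d := by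
    intro a b c d hab hbc hcd h h'
    obtain ⟨i, hai, hci⟩ := (adj_iff a c (hab.trans hbc)).1 h
    obtain ⟨j, hbj, hdj⟩ := (adj_iff b d (hbc.trans hcd)).1 h'
    simp only [Fin.lt_def] at hab hbc hcd
    have h1 : r ⟨b, by omega⟩ i := (hiff _ i).2 (by simp only; omega)
    have h2 : r ⟨b, by omega⟩ j := (hiff _ j).2 (by simp only; omega)
    rcases hr.forest _ i j h1 h2 with h3 | h3
    · have := nest i j h3
      omega
    · have := nest j i h3
      omega
  -- The two ends of a side `k` are joined through the edge of `k` and the smaller sides below it.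
  have reach : ∀ l (k : Fin n), hi k - lo k = l → G.Reachable k.castSucc k.succ := by
    intro l
    induction l using Nat.strong_induction_on with
    | _ l ih =>
    intro k hk
    have hk1 := hself k
    have hk2 := hle k
    have side : ∀ j : Fin n, r j k → j ≠ k → G.Reachable j.castSucc j.succ := by
      intro j hj hjk
      have h1 := nest j k hj
      have h2 : ¬ (lo j = lo k ∧ hi j = hi k) := fun h => hjk (inj j k h.1 h.2)
      have h3 := hself j
      exact ih (hi j - lo j) (by omega) j rfl
    have chain : ∀ x y (hxy : x ≤ y) (hy : y ≤ n), (∀ j : Fin n, x ≤ j → j < y →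
        r j k ∧ j ≠ k) → G.Reachable ⟨x, by omega⟩ ⟨y, by omega⟩ := by
      intro x y hxy
      induction y, hxy using Nat.le_induction with
      | base => exact fun _ _ => .refl _
      | succ y hxy ihy =>
        intro hy h
        have h1 := h ⟨y, by omega⟩ hxy (Nat.lt_succ_self y)
        exact (ihy (by omega) fun j h2 h3 => h j h2 (by omega)).trans
          (side ⟨y, by omega⟩ h1.1 h1.2)
    have c1 := chain (lo k) k hk1.1 (by omega) fun j h1 h2 =>
      ⟨(hiff j k).2 (by omega), by rintro rfl; omega⟩
    have c2 := chain (k + 1) (hi k) hk1.2 hk2 fun j h1 h2 =>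
      ⟨(hiff j k).2 (by omega), by rintro rfl; omega⟩
    have e : G.Adj ⟨lo k, by omega⟩ ⟨hi k, by omega⟩ := ⟨k, .inl ⟨rfl, rfl⟩⟩
    exact c1.symm.trans (e.reachable.trans c2.symm)
  have connected : G.Connected := by
    have h0 : ∀ x (hx : x < n + 1), G.Reachable ⟨0, by omega⟩ ⟨x, hx⟩ := by
      intro x
      induction x with
      | zero => exact fun _ => .refl _
      | succ x ih => exact fun hx => (ih (by omega)).trans (reach _ ⟨x, by omega⟩ rfl)
    have : Nonempty (Fin (n + 1)) := ⟨0⟩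
    exact ⟨fun x y => (h0 x x.2).symm.trans (h0 y y.2)⟩
  have card : Nat.card G.edgeSet = n := by
    rw [SimpleGraph.card_edgeSet_eq]
    conv_rhs => rw [← Nat.card_fin n]
    symm
    refine Nat.card_congr (Equiv.ofBijective (fun k => ⟨(⟨lo k, ?_⟩, ⟨hi k, ?_⟩), ?_, ?_⟩) ⟨?_, ?_⟩)
    · have := hself k
      omega
    · have := hle k
      omega
    · have := hself k
      exact Fin.lt_def.2 (by simp only; omega)
    · exact ⟨k, .inl ⟨rfl, rfl⟩⟩
    · intro i j hij
      simp only [Subtype.mk.injEq, Prod.mk.injEq, Fin.mk.injEq] at hij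
      exact inj i j hij.1 hij.2
    · rintro ⟨⟨x, y⟩, hxy, h⟩
      obtain ⟨i, h1, h2⟩ := (adj_iff x y hxy).1 h
      exact ⟨i, Subtype.ext (Prod.ext (Fin.ext h1.symm) (Fin.ext h2.symm))⟩
  let T : NCTree n := ⟨hn, G, SimpleGraph.isTree_iff_connected_and_card.2
    ⟨connected, by rw [card, Nat.card_fin]⟩, noncrossing⟩
  have he : ∀ a b, T.E a b ↔ ∃ i, a = lo i ∧ b = hi i := by
    intro a b
    constructor
    · rintro ⟨x, y, h, rfl, rfl⟩
      exact (adj_iff x y h.1).1 h.2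
    · rintro ⟨i, rfl, rfl⟩
      have h1 := hself i
      have h2 := hle i
      exact ⟨⟨lo i, by omega⟩, ⟨hi i, by omega⟩, ⟨Fin.lt_def.2 (by simp only; omega),
        i, .inl ⟨rfl, rfl⟩⟩, rfl, rfl⟩
  refine ⟨T, ?_⟩
  funext i j
  have hlab : T.Lab (lo j) (hi j) j := by
    refine ⟨(he _ _).2 ⟨j, rfl, rfl⟩, (hself j).1, (hself j).2, fun c d hcd h1 h2 h3 h4 => ?_⟩
    obtain ⟨k, rfl, rfl⟩ := (he _ _).1 hcd
    obtain rfl := hr.antisymm j k ((hiff j k).2 ⟨h3, h4⟩)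
      ((hiff k j).2 (by have := hself k; omega))
    exact ⟨rfl, rfl⟩
  exact propext ((hlab.isSpan.2 i).trans (hiff i j).symm)

end NCTree

/-! ### Disjoint unions and new maximal elements -/

section Relations

variable {m n : ℕ}

/-- The disjoint union of a relation on `Fin m` and of a relation on `Fin n`, the elements of the
latter being shifted by `m`. -/
def sumRel (r : Fin m → Fin m → Prop) (r' : Fin n → Fin n → Prop) (x y : Fin (m + n)) : Prop :=
  (∃ i j, x = Fin.castAdd n i ∧ y = Fin.castAdd n j ∧ r i j) ∨
    ∃ i j, x = Fin.natAdd m i ∧ y = Fin.natAdd m j ∧ r' i j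

/-- The relation obtained from `q` by putting all the elements below `i₀`. -/
def addTop (q : Fin n → Fin n → Prop) (i₀ : Fin n) (x y : Fin n) : Prop := q x y ∨ y = i₀

theorem Fin.castAdd_ne_natAdd (i : Fin m) (j : Fin n) : Fin.castAdd n i ≠ Fin.natAdd m j := by
  intro h
  have := congrArg Fin.val h
  simp only [Fin.val_castAdd, Fin.val_natAdd] at this
  omega

variable {r : Fin m → Fin m → Prop} {r' : Fin n → Fin n → Prop}

@[simp] theorem sumRel_castAdd_castAdd {i j : Fin m} :
    sumRel r r' (Fin.castAdd n i) (Fin.castAdd n j) ↔ r i j := by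
  constructor
  · rintro (⟨a, b, h1, h2, h⟩ | ⟨a, b, h1, h2, h⟩)
    · rwa [Fin.castAdd_injective _ _ h1, Fin.castAdd_injective _ _ h2]
    · exact absurd h1 (Fin.castAdd_ne_natAdd _ _)
  · exact fun h => .inl ⟨i, j, rfl, rfl, h⟩

@[simp] theorem sumRel_natAdd_natAdd {i j : Fin n} :
    sumRel r r' (Fin.natAdd m i) (Fin.natAdd m j) ↔ r' i j := by
  constructor
  · rintro (⟨a, b, h1, h2, h⟩ | ⟨a, b, h1, h2, h⟩)
    · exact absurd h1.symm (Fin.castAdd_ne_natAdd _ _)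
    · rwa [Fin.natAdd_injective _ _ h1, Fin.natAdd_injective _ _ h2]
  · exact fun h => .inr ⟨i, j, rfl, rfl, h⟩

@[simp] theorem not_sumRel_castAdd_natAdd {i : Fin m} {j : Fin n} :
    ¬ sumRel r r' (Fin.castAdd n i) (Fin.natAdd m j) := by
  rintro (⟨a, b, h1, h2, h⟩ | ⟨a, b, h1, h2, h⟩)
  · exact Fin.castAdd_ne_natAdd _ _ h2.symm
  · exact Fin.castAdd_ne_natAdd _ _ h1

@[simp] theorem not_sumRel_natAdd_castAdd {i : Fin m} {j : Fin n} :
    ¬ sumRel r r' (Fin.natAdd m j) (Fin.castAdd n i) := by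
  rintro (⟨a, b, h1, h2, h⟩ | ⟨a, b, h1, h2, h⟩)
  · exact Fin.castAdd_ne_natAdd _ _ h1.symm
  · exact Fin.castAdd_ne_natAdd _ _ h2

theorem IsNonInterleavingForest.sumRel (h : IsNonInterleavingForest r)
    (h' : IsNonInterleavingForest r') : IsNonInterleavingForest (sumRel r r') where
  refl i := by
    induction i using Fin.addCases with
    | left i => simpa using h.refl i
    | right i => simpa using h'.refl i
  antisymm i j h1 h2 := by
    induction i using Fin.addCases <;> induction j using Fin.addCases <;> simp at h1 h2
    · rw [h.antisymm _ _ h1 h2]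
    · rw [h'.antisymm _ _ h1 h2]
  trans i j k h1 h2 := by
    induction i using Fin.addCases <;> induction j using Fin.addCases <;>
      induction k using Fin.addCases <;> simp at h1 h2 ⊢
    · exact h.trans _ _ _ h1 h2
    · exact h'.trans _ _ _ h1 h2
  forest i j k h1 h2 := by
    induction i using Fin.addCases <;> induction j using Fin.addCases <;>
      induction k using Fin.addCases <;> simp at h1 h2 ⊢
    · exact h.forest _ _ _ h1 h2
    · exact h'.forest _ _ _ h1 h2
  interval i := by
    refine ⟨fun j h1 k h2 l hl => ?_⟩
    have hl1 : j.val ≤ l.val := hl.1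
    have hl2 : l.val ≤ k.val := hl.2
    induction i using Fin.addCases <;> induction j using Fin.addCases <;>
      induction k using Fin.addCases <;> simp at h1 h2 <;> induction l using Fin.addCases <;>
      simp at hl1 hl2 ⊢
    · exact (h.interval _).out h1 h2 ⟨hl1, hl2⟩
    · omega
    · omega
    · exact (h'.interval _).out h1 h2 ⟨hl1, hl2⟩

theorem IsNonInterleavingForest.addTop {q : Fin n → Fin n → Prop} (h : IsNonInterleavingForest q)
    {i₀ : Fin n} (hi : ∀ j, q i₀ j → j = i₀) : IsNonInterleavingForest (addTop q i₀) where
  refl i := .inl (h.refl i)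
  antisymm i j := by
    rintro (h1 | rfl) (h2 | rfl)
    · exact h.antisymm i j h1 h2
    · exact (hi j h1).symm
    · exact hi i h2
    · rfl
  trans i j k := by
    rintro (h1 | rfl) (h2 | rfl)
    · exact .inl (h.trans i j k h1 h2)
    · exact .inr rfl
    · exact .inr (hi k h2)
    · exact .inr rfl
  forest i j k := by
    rintro (h1 | rfl) (h2 | rfl)
    · exact (h.forest i j k h1 h2).imp .inl .inl
    · exact .inl (.inr rfl)
    · exact .inr (.inr rfl)
    · exact .inl (.inr rfl)
  interval i := by
    refine ⟨fun j h1 k h2 l hl => ?_⟩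
    rcases h1 with h1 | rfl
    · rcases h2 with h2 | rfl
      · exact .inl ((h.interval i).out h1 h2 hl)
      · exact .inr rfl
    · exact .inr rfl

theorem isSpan_sumRel_castAdd (h : IsNonInterleavingForest r) (h' : IsNonInterleavingForest r')
    {i : Fin m} {a b : ℕ} : IsSpan (sumRel r r') (Fin.castAdd n i) a b ↔ IsSpan r i a b := by
  have key : ∀ a b, IsSpan r i a b → IsSpan (sumRel r r') (Fin.castAdd n i) a b := by
    rintro a b ⟨h1, h2⟩
    refine ⟨by omega, fun j => ?_⟩
    induction j using Fin.addCases with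
    | left j => simpa using h2 j
    | right j => simp; omega
  refine ⟨fun h1 => ?_, key a b⟩
  obtain ⟨c, d, h2⟩ := h.exists_isSpan i
  obtain ⟨rfl, rfl⟩ := h1.unique ((h.sumRel h').refl _) (key c d h2)
  exact h2

theorem isSpan_sumRel_natAdd (h : IsNonInterleavingForest r) (h' : IsNonInterleavingForest r')
    {i : Fin n} {a b : ℕ} : IsSpan (sumRel r r') (Fin.natAdd m i) a b ↔
      ∃ c d, IsSpan r' i c d ∧ a = m + c ∧ b = m + d := by
  have key : ∀ a b, IsSpan r' i a b → IsSpan (sumRel r r') (Fin.natAdd m i) (m + a) (m + b) := by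
    rintro a b ⟨h1, h2⟩
    refine ⟨by omega, fun j => ?_⟩
    induction j using Fin.addCases with
    | left j => simp; omega
    | right j => simpa using h2 j
  constructor
  · intro h1
    obtain ⟨c, d, h2⟩ := h'.exists_isSpan i
    obtain ⟨rfl, rfl⟩ := h1.unique ((h.sumRel h').refl _) (key c d h2)
    exact ⟨c, d, h2, rfl, rfl⟩
  · rintro ⟨c, d, h1, rfl, rfl⟩
    exact key c d h1

theorem isSpan_addTop {q : Fin n → Fin n → Prop} (h : IsNonInterleavingForest q)
    {i₀ : Fin n} (hi : ∀ j, q i₀ j → j = i₀) {k : Fin n} {a b : ℕ} :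
    IsSpan (addTop q i₀) k a b ↔ (k = i₀ ∧ a = 0 ∧ b = n) ∨ (k ≠ i₀ ∧ IsSpan q k a b) := by
  by_cases hk : k = i₀
  · subst hk
    have h1 : IsSpan (addTop q k) k 0 n := ⟨le_rfl, fun j => by simp [addTop]⟩
    constructor
    · intro h2
      exact .inl ⟨rfl, h2.unique ((h.addTop hi).refl _) h1⟩
    · rintro (⟨_, rfl, rfl⟩ | ⟨h2, _⟩)
      · exact h1
      · exact absurd rfl h2
  · simp [IsSpan, addTop, hk]

end Relations

/-! ### The composites of the trees with two edges -/

namespace NCTree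

variable {n : ℕ}

/-- A tree is recognized by its poset or, equivalently, by its edges being the spans. -/
theorem posetLE_eq_iff {q : Fin n → Fin n → Prop} (hq : IsNonInterleavingForest q)
    (T : NCTree n) : T.posetLE = q ↔ ∀ a b, T.E a b ↔ ∃ k, IsSpan q k a b := by
  constructor
  · rintro rfl a b
    exact T.e_iff_isSpan
  · intro h
    obtain ⟨T', hT'⟩ := exists_posetLE_eq hq T.pos
    rw [← hT', eq_of_e_iff (T := T) (T' := T')]
    intro a b
    rw [h, e_iff_isSpan, hT']

/-- The outer edges are the ones numbered by the maximal elements. -/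
theorem isOuter_iff (T : NCTree n) {x y : Fin (n + 1)} :
    T.IsOuter x y ↔ ∃ i, (∀ j, T.posetLE i j → j = i) ∧ IsSpan T.posetLE i x y := by
  have hT := T.isNonInterleavingForest_posetLE
  constructor
  · rintro ⟨h, hmax⟩
    obtain ⟨i, hi⟩ := T.e_iff_isSpan.1 (e_val_iff.2 h)
    refine ⟨i, fun j hij => ?_, hi⟩
    obtain ⟨k, hk, hlab⟩ := (e_val_iff.2 h).exists_lab
    obtain ⟨c, d, hcd⟩ := T.exists_lab j.2
    obtain ⟨a, b, hab⟩ := T.exists_lab i.2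
    obtain ⟨rfl, rfl⟩ := hi.unique (hT.refl i) hab.isSpan
    have h1 := (hcd.isSpan.2 i).1 hij
    have h2 := hab.le_of_e hcd.1 h1.1 h1.2
    obtain ⟨z, w, hzw, rfl, rfl⟩ := hcd.1
    obtain ⟨rfl, rfl⟩ := hmax z w hzw h2.1 h2.2
    exact Fin.ext (hcd.injective hab)
  · rintro ⟨i, hi, hspan⟩
    refine ⟨e_val_iff.1 (T.e_iff_isSpan.2 ⟨i, hspan⟩), fun c d hcd h1 h2 => ?_⟩
    obtain ⟨j, hj⟩ := T.e_iff_isSpan.1 (e_val_iff.2 hcd)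
    have h3 := (hspan.2 i).1 (hT.refl i)
    obtain rfl := hi j ((hj.2 i).2 ⟨le_trans h1 h3.1, lt_of_lt_of_le h3.2 h2⟩)
    have h4 := hj.unique (hT.refl j) hspan
    exact ⟨Fin.ext h4.1, Fin.ext h4.2⟩

theorem star_edge_iff (k a b : Fin 3) : (star k).Edge a b ↔ a < b ∧ (a = k ∨ b = k) := by
  unfold Edge star
  rw [SimpleGraph.starGraph_adj]
  exact and_congr_right fun h => and_iff_right h.ne

section Composite

variable {m : ℕ}

/-- The edges of the composites of the trees with two edges: the base, present if `long` holds,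
the edges of `A` and the edges of `B` shifted by `m`. -/
def GluedEdge (long : Prop) (m n : ℕ) (A B : ℕ → ℕ → Prop) (x y : ℕ) : Prop :=
  (long ∧ x = 0 ∧ y = m + n) ∨ A x y ∨ ∃ c d, B c d ∧ x = m + c ∧ y = m + d

/-- The edges of `S` outside `D`, the vertices being natural numbers. -/
def EdgeOutside (S : NCTree m) (D : Set (Fin (m + 1) × Fin (m + 1))) (x y : ℕ) : Prop :=
  ∃ c d : Fin (m + 1), S.Edge c d ∧ (c, d) ∉ D ∧ x = c ∧ y = d

theorem edgeOutside_empty (S : NCTree m) : EdgeOutside S ∅ = S.E := by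
  funext x y
  refine propext ⟨?_, ?_⟩
  · rintro ⟨c, d, h, _, rfl, rfl⟩
    exact e_val_iff.2 h
  · rintro ⟨c, d, h, rfl, rfl⟩
    exact ⟨c, d, h, id, rfl, rfl⟩

theorem edgeOutside_singleton (S : NCTree m) {i : Fin m} {c d : Fin (m + 1)}
    (hi : IsSpan S.posetLE i c d) :
    EdgeOutside S {(c, d)} = fun x y => ∃ k, k ≠ i ∧ IsSpan S.posetLE k x y := by
  have hS := S.isNonInterleavingForest_posetLE
  funext x y
  refine propext ⟨?_, ?_⟩
  · rintro ⟨x, y, h, hne, rfl, rfl⟩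
    obtain ⟨k, hk⟩ := S.e_iff_isSpan.1 (e_val_iff.2 h)
    refine ⟨k, ?_, hk⟩
    rintro rfl
    have h1 := hk.unique (hS.refl k) hi
    exact hne (Prod.ext (Fin.ext h1.1) (Fin.ext h1.2))
  · rintro ⟨k, hki, hk⟩
    obtain ⟨x, y, h, rfl, rfl⟩ := S.e_iff_isSpan.2 ⟨k, hk⟩
    refine ⟨x, y, h, fun h1 => hki ?_, rfl, rfl⟩
    obtain ⟨rfl, rfl⟩ := Prod.mk.inj h1
    exact hS.antisymm _ _ ((hi.2 k).2 ((hk.2 k).1 (hS.refl k)))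
      ((hk.2 i).2 ((hi.2 i).1 (hS.refl i)))

theorem sum_sigma_fst (S : NCTree m) (S' : NCTree n) :
    ∑ j, ((![⟨m, S⟩, ⟨n, S'⟩] : Fin 2 → Σ m : ℕ, NCTree m) j).1 = m + n := by
  simp [Fin.sum_univ_two]

/-- The terms of a composite of a tree with two edges, with vertices in `ℕ`: the base is an edge
unless `k = 1`, and an edge is removed from `S` for `k = 2` and from `S'` for `k = 0`. -/
theorem isComposite_star_iff (k : Fin 3) (S : NCTree m) (S' : NCTree n)
    (R : NCTree (∑ j, ((![⟨m, S⟩, ⟨n, S'⟩] : Fin 2 → Σ m : ℕ, NCTree m) j).1)) :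
    (star k).IsComposite ![⟨m, S⟩, ⟨n, S'⟩] R ↔
      ∃ D D', (k ≠ 2 → D = ∅) ∧ (k = 2 → ∃ c d, S.IsOuter c d ∧ D = {(c, d)}) ∧
        (k ≠ 0 → D' = ∅) ∧ (k = 0 → ∃ c d, S'.IsOuter c d ∧ D' = {(c, d)}) ∧
        ∀ x y, R.E x y ↔ GluedEdge (k ≠ 1) m n (EdgeOutside S D) (EdgeOutside S' D') x y := by
  have hN := sum_sigma_fst S S'
  have o0 : offset (fun j => ((![⟨m, S⟩, ⟨n, S'⟩] : Fin 2 → Σ m : ℕ, NCTree m) j).1) 0 = 0 := by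
    simp [offset]
  have o1 : offset (fun j => ((![⟨m, S⟩, ⟨n, S'⟩] : Fin 2 → Σ m : ℕ, NCTree m) j).1) 1 = m := by
    simp [offset, Finset.sum_filter]
  have o2 : offset (fun j => ((![⟨m, S⟩, ⟨n, S'⟩] : Fin 2 → Σ m : ℕ, NCTree m) j).1) 2 =
      m + n := by
    simp [offset, Finset.sum_filter, Fin.sum_univ_two]
  have e0 : (star k).Edge (Fin.castSucc 0) (Fin.succ 0) ↔ k ≠ 2 := by
    rw [star_edge_iff]; revert k; decide
  have e1 : (star k).Edge (Fin.castSucc 1) (Fin.succ 1) ↔ k ≠ 0 := by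
    rw [star_edge_iff]; clear e0; revert k; decide
  have e2 : ∀ a b, (star k).Edge a b ∧ b.val ≠ a.val + 1 ↔ k ≠ 1 ∧ a = 0 ∧ b = 2 := by
    intro a b
    rw [star_edge_iff]; clear e0 e1; revert k a b; decide
  have glue : ∀ (D : (j : Fin 2) →
      Set (Fin (((![⟨m, S⟩, ⟨n, S'⟩] : Fin 2 → Σ m : ℕ, NCTree m) j).1 + 1) ×
        Fin (((![⟨m, S⟩, ⟨n, S'⟩] : Fin 2 → Σ m : ℕ, NCTree m) j).1 + 1))) (x y : ℕ),
      ((∃ a b, (star k).Edge a b ∧ b.val ≠ a.val + 1 ∧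
        x = offset (fun j => ((![⟨m, S⟩, ⟨n, S'⟩] : Fin 2 → Σ m : ℕ, NCTree m) j).1) a ∧
        y = offset (fun j => ((![⟨m, S⟩, ⟨n, S'⟩] : Fin 2 → Σ m : ℕ, NCTree m) j).1) b) ∨
      (∃ j c d, ((![⟨m, S⟩, ⟨n, S'⟩] : Fin 2 → Σ m : ℕ, NCTree m) j).2.Edge c d ∧ (c, d) ∉ D j ∧
        x = offset (fun j => ((![⟨m, S⟩, ⟨n, S'⟩] : Fin 2 → Σ m : ℕ, NCTree m) j).1) j + c ∧
        y = offset (fun j => ((![⟨m, S⟩, ⟨n, S'⟩] : Fin 2 → Σ m : ℕ, NCTree m) j).1) j + d)) ↔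
      GluedEdge (k ≠ 1) m n (EdgeOutside S (D 0)) (EdgeOutside S' (D 1)) x y := by
    intro D x y
    unfold GluedEdge
    refine or_congr ?_ ?_
    · constructor
      · rintro ⟨a, b, h1, h2, h3, h4⟩
        obtain ⟨h5, rfl, rfl⟩ := (e2 a b).1 ⟨h1, h2⟩
        exact ⟨h5, h3.trans o0, h4.trans o2⟩
      · rintro ⟨h5, rfl, rfl⟩
        obtain ⟨h1, h2⟩ := (e2 0 2).2 ⟨h5, rfl, rfl⟩
        exact ⟨0, 2, h1, h2, o0.symm, o2.symm⟩
    · rw [Fin.exists_fin_two]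
      refine or_congr ?_ ?_
      · constructor
        · rintro ⟨c, d, h1, h2, h3, h4⟩
          exact ⟨c, d, h1, h2, h3.trans (by erw [o0, zero_add]), h4.trans (by erw [o0, zero_add])⟩
        · rintro ⟨c, d, h1, h2, rfl, rfl⟩
          exact ⟨c, d, h1, h2, by erw [o0, zero_add], by erw [o0, zero_add]⟩
      · constructor
        · rintro ⟨c, d, h1, h2, h3, h4⟩
          exact ⟨c, d, ⟨c, d, h1, h2, rfl, rfl⟩, h3.trans (by erw [o1]), h4.trans (by erw [o1])⟩
        · rintro ⟨_, _, ⟨c, d, h1, h2, rfl, rfl⟩, rfl, rfl⟩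
          exact ⟨c, d, h1, h2, by erw [o1], by erw [o1]⟩
  have bound : ∀ D D' x y, GluedEdge (k ≠ 1) m n (EdgeOutside S D) (EdgeOutside S' D') x y →
      x ≤ m + n ∧ y ≤ m + n := by
    rintro D D' x y (⟨_, rfl, rfl⟩ | ⟨c, d, _, _, rfl, rfl⟩ |
      ⟨_, _, ⟨c, d, _, _, rfl, rfl⟩, rfl, rfl⟩) <;> omega
  have toNat : ∀ Q : ℕ → ℕ → Prop, (∀ x y, Q x y → x ≤ m + n ∧ y ≤ m + n) →
      ((∀ x y, R.Edge x y ↔ Q x y) ↔ ∀ x y, R.E x y ↔ Q x y) := by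
    intro Q hQ
    constructor
    · intro h x y
      constructor
      · rintro ⟨x, y, hxy, rfl, rfl⟩
        exact (h x y).1 hxy
      · intro hxy
        have h1 := hQ x y hxy
        exact ⟨⟨x, by omega⟩, ⟨y, by omega⟩, (h _ _).2 hxy, rfl, rfl⟩
    · intro h x y
      rw [← h, e_val_iff]
  unfold IsComposite
  constructor
  · rintro ⟨D, h1, h2⟩
    refine ⟨D 0, D 1, fun h => (h1 0).1 (e0.2 h), fun h => (h1 0).2 (by rw [e0]; simpa using h),
      fun h => (h1 1).1 (e1.2 h), fun h => (h1 1).2 (by rw [e1]; simpa using h),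
      (toNat _ (bound (D 0) (D 1))).1 fun x y => ?_⟩
    rw [h2, glue]
  · rintro ⟨D, D', h1, h2, h3, h4, h5⟩
    refine ⟨fun j => match j with
      | 0 => D
      | 1 => D', ?_, ?_⟩
    · rw [Fin.forall_fin_two, e0, e1, not_not, not_not]
      exact ⟨⟨h1, h2⟩, h3, h4⟩
    · rw [← toNat _ (bound _ _)] at h5
      intro x y
      rw [h5, glue]

variable (K : Type*) [CommRing K]

/-- Compares sums over trees with `N` and with `M` edges, where `N = M` need not hold by
definition; trees of the two types are matched through their edges in `ℕ`. -/
theorem sum_basis_congr {N M : ℕ} (h : N = M) (p : NCTree N → Prop) (q : NCTree M → Prop)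
    [DecidablePred p] [DecidablePred q]
    (hpq : ∀ (R : NCTree N) (R' : NCTree M), (∀ a b, R.E a b ↔ R'.E a b) → (p R ↔ q R')) :
    ∑ R : NCTree N with p R, R.basis K = ∑ R : NCTree M with q R, R.basis K := by
  subst h
  exact Finset.sum_congr (Finset.filter_congr fun R _ => hpq R R fun _ _ => Iff.rfl) fun _ _ => rfl

theorem gluedEdge_false_iff (S : NCTree m) (S' : NCTree n) (x y : ℕ) :
    GluedEdge False m n S.E S'.E x y ↔ ∃ k, IsSpan (sumRel S.posetLE S'.posetLE) k x y := by
  have hS := S.isNonInterleavingForest_posetLE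
  have hS' := S'.isNonInterleavingForest_posetLE
  simp only [GluedEdge, e_iff_isSpan, false_and, false_or]
  constructor
  · rintro (⟨i, h⟩ | ⟨c, d, ⟨i, h⟩, rfl, rfl⟩)
    · exact ⟨_, (isSpan_sumRel_castAdd hS hS').2 h⟩
    · exact ⟨_, (isSpan_sumRel_natAdd hS hS').2 ⟨c, d, h, rfl, rfl⟩⟩
  · rintro ⟨k, h⟩
    induction k using Fin.addCases with
    | left k => exact .inl ⟨k, (isSpan_sumRel_castAdd hS hS').1 h⟩
    | right k =>
      obtain ⟨c, d, h', rfl, rfl⟩ := (isSpan_sumRel_natAdd hS hS').1 h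
      exact .inr ⟨c, d, ⟨k, h'⟩, rfl, rfl⟩

theorem castAdd_maximal_iff {r : Fin m → Fin m → Prop} {r' : Fin n → Fin n → Prop} {i : Fin m} :
    (∀ j, sumRel r r' (Fin.castAdd n i) j → j = Fin.castAdd n i) ↔ ∀ j, r i j → j = i := by
  refine ⟨fun h j hij => Fin.castAdd_injective _ _ (h _ (by simpa using hij)), fun h j hij => ?_⟩
  induction j using Fin.addCases with
  | left j => rw [h j (by simpa using hij)]
  | right j => simp at hij

theorem natAdd_maximal_iff {r : Fin m → Fin m → Prop} {r' : Fin n → Fin n → Prop} {i : Fin n} :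
    (∀ j, sumRel r r' (Fin.natAdd m i) j → j = Fin.natAdd m i) ↔ ∀ j, r' i j → j = i := by
  refine ⟨fun h j hij => Fin.natAdd_injective _ _ (h _ (by simpa using hij)), fun h j hij => ?_⟩
  induction j using Fin.addCases with
  | left j => simp at hij
  | right j => rw [h j (by simpa using hij)]

theorem gluedEdge_left_iff (S : NCTree m) (S' : NCTree n) {i : Fin m} {c d : Fin (m + 1)}
    (hi : ∀ j, S.posetLE i j → j = i) (hc : IsSpan S.posetLE i c d) (x y : ℕ) :
    GluedEdge True m n (EdgeOutside S {(c, d)}) S'.E x y ↔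
      ∃ k, IsSpan (addTop (sumRel S.posetLE S'.posetLE) (Fin.castAdd n i)) k x y := by
  have hS := S.isNonInterleavingForest_posetLE
  have hS' := S'.isNonInterleavingForest_posetLE
  rw [edgeOutside_singleton S hc]
  simp only [GluedEdge, e_iff_isSpan, true_and, isSpan_addTop (hS.sumRel hS')
    (castAdd_maximal_iff.2 hi), exists_or, exists_eq_left]
  refine or_congr Iff.rfl ⟨?_, ?_⟩
  · rintro (⟨k, hk, h⟩ | ⟨c, d, ⟨k, h⟩, rfl, rfl⟩)
    · exact ⟨_, fun h1 => hk (Fin.castAdd_injective _ _ h1), (isSpan_sumRel_castAdd hS hS').2 h⟩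
    · exact ⟨_, (Fin.castAdd_ne_natAdd i k).symm,
        (isSpan_sumRel_natAdd hS hS').2 ⟨c, d, h, rfl, rfl⟩⟩
  · rintro ⟨k, hk, h⟩
    induction k using Fin.addCases with
    | left k =>
      exact .inl ⟨k, fun h1 => hk (by rw [h1]), (isSpan_sumRel_castAdd hS hS').1 h⟩
    | right k =>
      obtain ⟨c, d, h', rfl, rfl⟩ := (isSpan_sumRel_natAdd hS hS').1 h
      exact .inr ⟨c, d, ⟨k, h'⟩, rfl, rfl⟩

theorem gluedEdge_right_iff (S : NCTree m) (S' : NCTree n) {i : Fin n} {c d : Fin (n + 1)}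
    (hi : ∀ j, S'.posetLE i j → j = i) (hc : IsSpan S'.posetLE i c d) (x y : ℕ) :
    GluedEdge True m n S.E (EdgeOutside S' {(c, d)}) x y ↔
      ∃ k, IsSpan (addTop (sumRel S.posetLE S'.posetLE) (Fin.natAdd m i)) k x y := by
  have hS := S.isNonInterleavingForest_posetLE
  have hS' := S'.isNonInterleavingForest_posetLE
  rw [edgeOutside_singleton S' hc]
  simp only [GluedEdge, e_iff_isSpan, true_and, isSpan_addTop (hS.sumRel hS')
    (natAdd_maximal_iff.2 hi), exists_or, exists_eq_left]
  refine or_congr Iff.rfl ⟨?_, ?_⟩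
  · rintro (⟨k, h⟩ | ⟨c, d, ⟨k, hk, h⟩, rfl, rfl⟩)
    · exact ⟨_, Fin.castAdd_ne_natAdd k i, (isSpan_sumRel_castAdd hS hS').2 h⟩
    · exact ⟨_, fun h1 => hk (Fin.natAdd_injective _ _ h1),
        (isSpan_sumRel_natAdd hS hS').2 ⟨c, d, h, rfl, rfl⟩⟩
  · rintro ⟨k, hk, h⟩
    induction k using Fin.addCases with
    | left k =>
      exact .inl ⟨k, (isSpan_sumRel_castAdd hS hS').1 h⟩
    | right k =>
      obtain ⟨c, d, h', rfl, rfl⟩ := (isSpan_sumRel_natAdd hS hS').1 h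
      exact .inr ⟨c, d, ⟨k, fun h1 => hk (by rw [h1]), h'⟩, rfl, rfl⟩

open scoped Classical in
theorem composite_star_one (S : NCTree m) (S' : NCTree n) :
    (star 1).composite K ![⟨m, S⟩, ⟨n, S'⟩] =
      ∑ R : NCTree (m + n) with R.posetLE = sumRel S.posetLE S'.posetLE, R.basis K := by
  have hS := S.isNonInterleavingForest_posetLE
  have hS' := S'.isNonInterleavingForest_posetLE
  unfold composite
  refine sum_basis_congr K (sum_sigma_fst S S') _ _ fun R R' h => ?_
  rw [isComposite_star_iff, posetLE_eq_iff (hS.sumRel hS')]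
  simp only [h, ← gluedEdge_false_iff]
  constructor
  · rintro ⟨D, D', h1, -, h2, -, h3⟩
    obtain rfl := h1 (by decide)
    obtain rfl := h2 (by decide)
    simpa [edgeOutside_empty] using h3
  · intro h3
    exact ⟨∅, ∅, by simp, by simp, by simp, by simp, by simpa [edgeOutside_empty] using h3⟩

open scoped Classical in
/-- The number `i` of the edge removed from `S` becomes the number of the base, so that everything
is put below `i`. -/
theorem composite_star_two (S : NCTree m) (S' : NCTree n) :
    (star 2).composite K ![⟨m, S⟩, ⟨n, S'⟩] =
      ∑ R : NCTree (m + n) with ∃ i,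
        (∀ j, sumRel S.posetLE S'.posetLE (Fin.castAdd n i) j → j = Fin.castAdd n i) ∧
        R.posetLE = addTop (sumRel S.posetLE S'.posetLE) (Fin.castAdd n i), R.basis K := by
  have hS := S.isNonInterleavingForest_posetLE
  have hS' := S'.isNonInterleavingForest_posetLE
  unfold composite
  refine sum_basis_congr K (sum_sigma_fst S S') _ _ fun R R' h => ?_
  rw [isComposite_star_iff]
  simp only [h, castAdd_maximal_iff]
  constructor
  · rintro ⟨D, D', -, h1, h2, -, h3⟩
    obtain ⟨c, d, hcd, rfl⟩ := h1 (by simp)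
    obtain rfl := h2 (by decide)
    obtain ⟨i, hi, hspan⟩ := S.isOuter_iff.1 hcd
    refine ⟨i, hi, (posetLE_eq_iff ((hS.sumRel hS').addTop (castAdd_maximal_iff.2 hi)) R').2 ?_⟩
    simpa [edgeOutside_empty, ← gluedEdge_left_iff S S' hi hspan] using h3
  · rintro ⟨i, hi, hR⟩
    rw [posetLE_eq_iff ((hS.sumRel hS').addTop (castAdd_maximal_iff.2 hi))] at hR
    obtain ⟨c, d, hcd⟩ := hS.exists_isSpan i
    obtain ⟨c, d, hE, rfl, rfl⟩ := S.e_iff_isSpan.2 ⟨i, hcd⟩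
    refine ⟨{(c, d)}, ∅, by simp, fun _ => ⟨c, d, S.isOuter_iff.2 ⟨i, hi, hcd⟩, rfl⟩, by simp,
      fun h => absurd h (by decide), ?_⟩
    simpa [edgeOutside_empty, ← gluedEdge_left_iff S S' hi hcd] using hR

open scoped Classical in
theorem composite_star_zero (S : NCTree m) (S' : NCTree n) :
    (star 0).composite K ![⟨m, S⟩, ⟨n, S'⟩] =
      ∑ R : NCTree (m + n) with ∃ i,
        (∀ j, sumRel S.posetLE S'.posetLE (Fin.natAdd m i) j → j = Fin.natAdd m i) ∧
        R.posetLE = addTop (sumRel S.posetLE S'.posetLE) (Fin.natAdd m i), R.basis K := by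
  have hS := S.isNonInterleavingForest_posetLE
  have hS' := S'.isNonInterleavingForest_posetLE
  unfold composite
  refine sum_basis_congr K (sum_sigma_fst S S') _ _ fun R R' h => ?_
  rw [isComposite_star_iff]
  simp only [h, natAdd_maximal_iff]
  constructor
  · rintro ⟨D, D', h2, -, -, h1, h3⟩
    obtain ⟨c, d, hcd, rfl⟩ := h1 (by simp)
    obtain rfl := h2 (by decide)
    obtain ⟨i, hi, hspan⟩ := S'.isOuter_iff.1 hcd
    refine ⟨i, hi, (posetLE_eq_iff ((hS.sumRel hS').addTop (natAdd_maximal_iff.2 hi)) R').2 ?_⟩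
    simpa [edgeOutside_empty, ← gluedEdge_right_iff S S' hi hspan] using h3
  · rintro ⟨i, hi, hR⟩
    rw [posetLE_eq_iff ((hS.sumRel hS').addTop (natAdd_maximal_iff.2 hi))] at hR
    obtain ⟨c, d, hcd⟩ := hS'.exists_isSpan i
    obtain ⟨c, d, hE, rfl, rfl⟩ := S'.e_iff_isSpan.2 ⟨i, hcd⟩
    refine ⟨∅, {(c, d)}, by simp, fun h => absurd h (by decide), by simp,
      fun _ => ⟨c, d, S'.isOuter_iff.2 ⟨i, hi, hcd⟩, rfl⟩, ?_⟩
    simpa [edgeOutside_empty, ← gluedEdge_right_iff S S' hi hcd] using hR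

end Composite

end NCTree

/-! ### Standardization and sums over linear extensions -/

section LinearExtensions

variable {n : ℕ}

/-- The permutation whose letters stand in the order of the values of `f`. -/
theorem exists_perm_symm_lt_iff {α : Type*} [LinearOrder α] (f : Fin n → α)
    (hf : Function.Injective f) :
    ∃ σ : Equiv.Perm (Fin n), ∀ i j, f i < f j ↔ σ.symm i < σ.symm j := by
  have hmono : StrictMono (f ∘ Tuple.sort f) :=
    (Tuple.monotone_sort f).strictMono_of_injective (hf.comp (Tuple.sort f).injective)
  refine ⟨Tuple.sort f, fun i j => ?_⟩
  have h := hmono.lt_iff_lt (a := (Tuple.sort f).symm i) (b := (Tuple.sort f).symm j)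
  simpa using h

theorem perm_eq_of_symm_lt_iff {σ τ : Equiv.Perm (Fin n)}
    (h : ∀ i j, σ.symm i < σ.symm j ↔ τ.symm i < τ.symm j) : σ = τ := by
  let e : Fin n ≃o Fin n :=
    { toEquiv := σ.trans τ.symm
      map_rel_iff' := by
        intro a b
        have := h (σ b) (σ a)
        simp only [Equiv.symm_apply_apply] at this
        simpa using not_congr this.symm }
  have he : e = OrderIso.refl _ := Subsingleton.elim _ _
  ext1 x
  have h1 : τ.symm (σ x) = x := congrArg (fun e : Fin n ≃o Fin n => e x) he
  exact (Equiv.symm_apply_eq τ).1 h1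

theorem exists_isLinearExtension {r : Fin n → Fin n → Prop} (hr : IsNonInterleavingForest r) :
    ∃ σ, IsLinearExtension r σ := by
  classical
  -- The elements are sorted by the number of their descendants.
  let f : Fin n → ℕ := fun i => (Finset.univ.filter fun j => r j i).card
  refine ⟨Tuple.sort f, fun i j hij => ?_⟩
  rcases eq_or_ne i j with rfl | hne
  · exact le_rfl
  by_contra hlt
  have h1 := Tuple.monotone_sort f (not_le.1 hlt).le
  simp only [Function.comp_apply, Equiv.apply_symm_apply] at h1
  refine absurd h1 (not_le.2 (Finset.card_lt_card ?_))
  refine Finset.ssubset_iff_of_subset (fun k hk => ?_) |>.2 ⟨j, ?_, ?_⟩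
  · simp only [Finset.mem_filter, Finset.mem_univ, true_and] at hk ⊢
    exact hr.trans k i j hk hij
  · simpa using hr.refl j
  · simpa using fun hji => hne (hr.antisymm i j hij hji)

theorem isLinearExtension_addTop_iff {q : Fin n → Fin n → Prop} {i₀ : Fin n}
    {μ : Equiv.Perm (Fin n)} : IsLinearExtension (addTop q i₀) μ ↔
      IsLinearExtension q μ ∧ ∀ k, μ.symm k ≤ μ.symm i₀ := by
  constructor
  · exact fun h => ⟨fun i j hij => h i j (.inl hij), fun k => h k i₀ (.inr rfl)⟩
  · rintro ⟨h1, h2⟩ i j (hij | rfl)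
    · exact h1 i j hij
    · exact h2 i

variable (K : Type*) [CommRing K]

open scoped Classical in
/-- The sum of the `F_σ` over the linear extensions `σ` of a relation. -/
noncomputable def linExtSum (r : Fin n → Fin n → Prop) : FQSym K :=
  ∑ σ : Equiv.Perm (Fin n) with IsLinearExtension r σ, FQSym.F K σ

open scoped Classical in
/-- A linear extension of `q` is one of exactly one of the `addTop q i`, with `i` maximal: `i` is
its last letter. -/
theorem sum_linExtSum_addTop {N l : ℕ} (hN : 0 < N) {q : Fin N → Fin N → Prop}
    (hq : IsNonInterleavingForest q) (e : Fin l → Fin N) :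
    ∑ R : NCTree N with ∃ i, (∀ j, q (e i) j → j = e i) ∧ R.posetLE = addTop q (e i),
      linExtSum K R.posetLE =
    ∑ μ : Equiv.Perm (Fin N) with IsLinearExtension q μ ∧ ∃ i, ∀ k, μ.symm k ≤ μ.symm (e i),
      FQSym.F K μ := by
  unfold linExtSum
  rw [← Finset.sum_biUnion]
  · refine Finset.sum_congr ?_ fun _ _ => rfl
    ext μ
    simp only [Finset.mem_biUnion, Finset.mem_filter, Finset.mem_univ, true_and]
    constructor
    · rintro ⟨R, ⟨i, hi, hR⟩, hμ⟩
      rw [hR, isLinearExtension_addTop_iff] at hμ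
      exact ⟨hμ.1, i, hμ.2⟩
    · rintro ⟨hμ, i, hi⟩
      have hmax : ∀ j, q (e i) j → j = e i := fun j hj =>
        μ.symm.injective (le_antisymm (hi j) (hμ _ _ hj))
      obtain ⟨R, hR⟩ := NCTree.exists_posetLE_eq (hq.addTop hmax) hN
      exact ⟨R, ⟨i, hmax, hR⟩, by rw [hR, isLinearExtension_addTop_iff]; exact ⟨hμ, hi⟩⟩
  · intro R hR R' hR' hne
    simp only [Finset.coe_filter, Finset.mem_univ, true_and, Set.mem_ofPred_eq] at hR hR'
    obtain ⟨i, hi, hR⟩ := hR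
    obtain ⟨i', hi', hR'⟩ := hR'
    refine Finset.disjoint_left.2 fun μ hμ hμ' => hne (NCTree.posetLE_injective ?_)
    simp only [Finset.mem_filter, Finset.mem_univ, true_and] at hμ hμ'
    rw [hR, isLinearExtension_addTop_iff] at hμ
    rw [hR', isLinearExtension_addTop_iff] at hμ'
    rw [hR, hR', μ.symm.injective (le_antisymm (hμ'.2 (e i)) (hμ.2 (e i')))]

variable {m : ℕ}

open scoped Classical in
/-- The shifted shuffles of the linear extensions of `r` and of `r'` are the linear extensions of
the disjoint union, each obtained once. -/
theorem sum_shuffle (r : Fin m → Fin m → Prop) (r' : Fin n → Fin n → Prop)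
    (p : Equiv.Perm (Fin (m + n)) → Prop) [DecidablePred p] :
    ∑ σ : Equiv.Perm (Fin m) with IsLinearExtension r σ,
      ∑ τ : Equiv.Perm (Fin n) with IsLinearExtension r' τ,
        ∑ μ : Equiv.Perm (Fin (m + n)) with IsShiftedShuffle σ τ μ ∧ p μ, FQSym.F K μ =
    ∑ μ : Equiv.Perm (Fin (m + n)) with IsLinearExtension (sumRel r r') μ ∧ p μ,
      FQSym.F K μ := by
  choose f hf using fun μ : Equiv.Perm (Fin (m + n)) => exists_perm_symm_lt_iff
    (fun i : Fin m => μ.symm (Fin.castAdd n i))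
    (μ.symm.injective.comp (Fin.castAdd_injective m n))
  choose g hg using fun μ : Equiv.Perm (Fin (m + n)) => exists_perm_symm_lt_iff
    (fun i : Fin n => μ.symm (Fin.natAdd m i))
    (μ.symm.injective.comp (Fin.natAdd_injective n m))
  have hshuffle : ∀ σ τ μ, IsShiftedShuffle σ τ μ ↔ (f μ, g μ) = (σ, τ) := by
    intro σ τ μ
    rw [Prod.mk.injEq]
    constructor
    · rintro ⟨h1, h2⟩
      exact ⟨perm_eq_of_symm_lt_iff fun i j => (hf μ i j).symm.trans (h1 i j),
        perm_eq_of_symm_lt_iff fun i j => (hg μ i j).symm.trans (h2 i j)⟩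
    · rintro ⟨rfl, rfl⟩
      exact ⟨hf μ, hg μ⟩
  have hext : ∀ μ, IsLinearExtension (sumRel r r') μ ↔
      IsLinearExtension r (f μ) ∧ IsLinearExtension r' (g μ) := by
    intro μ
    constructor
    · intro h
      refine ⟨fun i j hij => ?_, fun i j hij => ?_⟩
      · rw [← not_lt, ← hf, not_lt]
        exact h _ _ (by simpa using hij)
      · rw [← not_lt, ← hg, not_lt]
        exact h _ _ (by simpa using hij)
    · rintro ⟨h1, h2⟩ _ _ (⟨i, j, rfl, rfl, hij⟩ | ⟨i, j, rfl, rfl, hij⟩)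
      · rw [← not_lt, hf μ j i, not_lt]
        exact h1 i j hij
      · rw [← not_lt, hg μ j i, not_lt]
        exact h2 i j hij
  rw [← Finset.sum_product',
    ← Finset.sum_fiberwise_of_maps_to (g := fun μ => (f μ, g μ))
      (s := Finset.univ.filter fun μ => IsLinearExtension (sumRel r r') μ ∧ p μ)
      (t := (Finset.univ.filter fun σ => IsLinearExtension r σ) ×ˢ
        (Finset.univ.filter fun τ => IsLinearExtension r' τ))]
  · refine Finset.sum_congr rfl fun x hx => Finset.sum_congr ?_ fun _ _ => rfl
    obtain ⟨σ, τ⟩ := x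
    simp only [Finset.mem_product, Finset.mem_filter, Finset.mem_univ, true_and] at hx
    ext μ
    simp only [Finset.mem_filter, Finset.mem_univ, true_and, hshuffle, hext]
    constructor
    · rintro ⟨h1, h2⟩
      obtain ⟨rfl, rfl⟩ := Prod.mk.inj h1
      exact ⟨⟨hx, h2⟩, rfl⟩
    · rintro ⟨⟨_, h2⟩, h1⟩
      exact ⟨h1, h2⟩
  · intro μ hμ
    simp only [Finset.mem_product, Finset.mem_filter, Finset.mem_univ, true_and] at hμ ⊢
    exact (hext μ).1 hμ.1

open scoped Classical in
theorem FQSym.prec_F (σ : Equiv.Perm (Fin m)) (τ : Equiv.Perm (Fin n)) :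
    FQSym.prec K (FQSym.F K σ) (FQSym.F K τ) =
      ∑ μ : Equiv.Perm (Fin (m + n)) with IsShiftedShuffle σ τ μ ∧
        ∃ i : Fin m, ∀ k, μ.symm k ≤ μ.symm (Fin.castAdd n i), FQSym.F K μ := by
  conv_lhs => rw [FQSym.prec, FQSym.F, FQSym.F, Finsupp.linearCombination_single, one_smul,
    Finsupp.linearCombination_single, one_smul]

open scoped Classical in
theorem FQSym.succ_F (σ : Equiv.Perm (Fin m)) (τ : Equiv.Perm (Fin n)) :
    FQSym.succ K (FQSym.F K σ) (FQSym.F K τ) =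
      ∑ μ : Equiv.Perm (Fin (m + n)) with IsShiftedShuffle σ τ μ ∧
        ∃ i : Fin n, ∀ k, μ.symm k ≤ μ.symm (Fin.natAdd m i), FQSym.F K μ := by
  conv_lhs => rw [FQSym.succ, FQSym.F, FQSym.F, Finsupp.linearCombination_single, one_smul,
    Finsupp.linearCombination_single, one_smul]

open scoped Classical in
theorem prec_linExtSum (r : Fin m → Fin m → Prop) (r' : Fin n → Fin n → Prop) :
    FQSym.prec K (linExtSum K r) (linExtSum K r') =
      ∑ μ : Equiv.Perm (Fin (m + n)) with IsLinearExtension (sumRel r r') μ ∧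
        ∃ i : Fin m, ∀ k, μ.symm k ≤ μ.symm (Fin.castAdd n i), FQSym.F K μ := by
  rw [← sum_shuffle K r r']
  simp only [linExtSum, map_sum, LinearMap.sum_apply, FQSym.prec_F]
  exact Finset.sum_comm

open scoped Classical in
theorem succ_linExtSum (r : Fin m → Fin m → Prop) (r' : Fin n → Fin n → Prop) :
    FQSym.succ K (linExtSum K r) (linExtSum K r') =
      ∑ μ : Equiv.Perm (Fin (m + n)) with IsLinearExtension (sumRel r r') μ ∧
        ∃ i : Fin n, ∀ k, μ.symm k ≤ μ.symm (Fin.natAdd m i), FQSym.F K μ := by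
  rw [← sum_shuffle K r r']
  simp only [linExtSum, map_sum, LinearMap.sum_apply, FQSym.succ_F]
  exact Finset.sum_comm

theorem prec_add_succ_linExtSum (hmn : 0 < m + n) (r : Fin m → Fin m → Prop)
    (r' : Fin n → Fin n → Prop) :
    FQSym.prec K (linExtSum K r) (linExtSum K r') +
      FQSym.succ K (linExtSum K r) (linExtSum K r') = linExtSum K (sumRel r r') := by
  classical
  rw [prec_linExtSum, succ_linExtSum, linExtSum, ← Finset.sum_union]
  · refine Finset.sum_congr ?_ fun _ _ => rfl
    ext μ
    simp only [Finset.mem_union, Finset.mem_filter, Finset.mem_univ, true_and, ← and_or_left]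
    refine and_iff_left ?_
    have : NeZero (m + n) := ⟨hmn.ne'⟩
    obtain ⟨i, hi⟩ : ∃ i, ∀ k, μ.symm k ≤ μ.symm i := ⟨μ (Fin.rev 0), fun k => by
      rw [Equiv.symm_apply_apply, Fin.le_rev_iff, Fin.le_def]
      simp⟩
    induction i using Fin.addCases with
    | left i => exact .inl ⟨i, hi⟩
    | right i => exact .inr ⟨i, hi⟩
  · refine Finset.disjoint_left.2 fun μ hμ hμ' => ?_
    simp only [Finset.mem_filter] at hμ hμ'
    obtain ⟨-, -, i, hi⟩ := hμ
    obtain ⟨-, -, j, hj⟩ := hμ'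
    exact Fin.castAdd_ne_natAdd i j (μ.symm.injective (le_antisymm (hj _) (hi _)))

end LinearExtensions

/-! ### Linear extensions and binary trees -/

open scoped Classical in
theorem PBT.P_eq (K : Type*) [CommRing K] {n : ℕ} {t : BinaryTree Unit} (h : t.numNodes = n) :
    PBT.P K t = ∑ σ : Equiv.Perm (Fin n) with
      HasDecreasingShape (List.ofFn fun k => (σ.symm k : ℕ)) t, FQSym.F K σ := by
  subst h
  rfl

/-- The linear extensions of a non-interleaving forest are the permutations for which the ancestor
relation of the decreasing tree of the inverse extends the forest. -/
theorem isLinearExtension_iff_anc {n : ℕ} {r : Fin n → Fin n → Prop}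
    (hr : IsNonInterleavingForest r) {σ : Equiv.Perm (Fin n)} {t : BinaryTree Unit}
    (ht : HasDecreasingShape (List.ofFn fun k => (σ.symm k : ℕ)) t) :
    IsLinearExtension r σ ↔ ∀ i j : Fin n, r j i → t.Anc i j := by
  have hget : ∀ k : Fin n, (List.ofFn fun k => (σ.symm k : ℕ)).getD k 0 = σ.symm k := fun k => by
    simp
  constructor
  · intro h i j hji
    rw [ht.anc_iff]
    simp only [List.length_ofFn]
    refine ⟨i.2, j.2, fun k hk => ?_⟩
    have hkn : k < n := by
      rw [Set.mem_uIcc] at hk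
      omega
    have hki : r ⟨k, hkn⟩ i := by
      rcases Set.mem_uIcc.1 hk with h1 | h1
      · exact (hr.interval i).out (hr.refl i) hji h1
      · exact (hr.interval i).out hji (hr.refl i) h1
    have h1 := hget ⟨k, hkn⟩
    simp only at h1
    rw [h1, hget i]
    exact h _ _ hki
  · intro h j i hji
    have h1 := ((ht.anc_iff i j).1 (h i j hji)).2.2 j Set.right_mem_uIcc
    rwa [hget, hget] at h1

theorem exists_tamariInterval_linExtSum_eq (K : Type*) [CommRing K] {n : ℕ}
    {r : Fin n → Fin n → Prop} (hr : IsNonInterleavingForest r) :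
    ∃ I : Finset (BinaryTree Unit), IsTamariInterval n I ∧
      linExtSum K r = ∑ t ∈ I, PBT.P K t := by
  classical
  let I := (BinaryTree.treesOfNumNodesEq n).filter fun t => ∀ i j : Fin n, r j i → t.Anc i j
  have hI : ∀ t, t ∈ I ↔ t.numNodes = n ∧ ∀ i j : Fin n, r j i → t.Anc i j := fun t => by
    simp [I, BinaryTree.mem_treesOfNumNodesEq]
  have hshape : ∀ σ : Equiv.Perm (Fin n), ∃ t, t.numNodes = n ∧
      HasDecreasingShape (List.ofFn fun k => (σ.symm k : ℕ)) t := by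
    intro σ
    obtain ⟨t, ht⟩ := exists_hasDecreasingShape (List.ofFn fun k => (σ.symm k : ℕ))
      (List.nodup_ofFn.2 (Fin.val_injective.comp σ.symm.injective))
    exact ⟨t, by simpa using ht.numNodes_eq, ht⟩
  refine ⟨I, isTamariInterval_of_anc (D := fun i j => ∃ (hi : i < n) (hj : j < n),
    r ⟨j, hj⟩ ⟨i, hi⟩) ?_ ?_ ?_ ?_, ?_⟩
  · intro t
    rw [hI]
    refine and_congr_right fun _ => ⟨?_, ?_⟩
    · rintro h i j _ _ ⟨hi, hj, hr⟩
      exact h _ _ hr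
    · exact fun h i j hij => h i j i.2 j.2 ⟨i.2, j.2, hij⟩
  · rintro i j k ⟨hi, hj, h⟩ hk
    have hkn : k < n := by
      rw [Set.mem_uIcc] at hk
      omega
    refine ⟨hi, hkn, ?_⟩
    rcases Set.mem_uIcc.1 hk with h1 | h1
    · exact (hr.interval _).out (hr.refl _) h h1
    · exact (hr.interval _).out h (hr.refl _) h1
  · rintro i j k ⟨hi, hj, h⟩ ⟨_, hk, h'⟩
    exact ⟨hi, hk, hr.trans _ _ _ h' h⟩
  · obtain ⟨σ, hσ⟩ := exists_isLinearExtension hr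
    obtain ⟨t, htn, ht⟩ := hshape σ
    exact ⟨t, (hI t).2 ⟨htn, (isLinearExtension_iff_anc hr ht).1 hσ⟩⟩
  · rw [Finset.sum_congr rfl fun t ht => PBT.P_eq K ((hI t).1 ht).1, ← Finset.sum_biUnion]
    · refine Finset.sum_congr ?_ fun _ _ => rfl
      ext σ
      simp only [Finset.mem_biUnion, Finset.mem_filter, Finset.mem_univ, true_and]
      constructor
      · intro hσ
        obtain ⟨t, htn, ht⟩ := hshape σ
        exact ⟨t, (hI t).2 ⟨htn, (isLinearExtension_iff_anc hr ht).1 hσ⟩, ht⟩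
      · rintro ⟨t, htI, ht⟩
        exact (isLinearExtension_iff_anc hr ht).2 ((hI t).1 htI).2
    · intro t _ t' _ hne
      refine Finset.disjoint_left.2 fun σ hσ hσ' => hne ?_
      simp only [Finset.mem_filter] at hσ hσ'
      exact hσ.2.unique hσ'.2

/-! ### Generation by the trees with two edges -/

theorem IsNonInterleavingForest.comap {l N : ℕ} {r : Fin N → Fin N → Prop}
    (hr : IsNonInterleavingForest r) {e : Fin l → Fin N} (he : StrictMono e) :
    IsNonInterleavingForest fun i j => r (e i) (e j) where
  refl _ := hr.refl _
  antisymm _ _ h1 h2 := he.injective (hr.antisymm _ _ h1 h2)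
  trans _ _ _ := hr.trans _ _ _
  forest _ _ _ := hr.forest _ _ _
  interval i := ⟨fun _ hj _ hk _ hl =>
    (hr.interval (e i)).out hj hk ⟨he.monotone hl.1, he.monotone hl.2⟩⟩

/-- The relation obtained from `q` by forgetting that the descendants of `i₀` are below it. -/
def eraseTop {n : ℕ} (q : Fin n → Fin n → Prop) (i₀ : Fin n) (x y : Fin n) : Prop :=
  x = y ∨ (y ≠ i₀ ∧ q x y)

theorem IsNonInterleavingForest.eraseTop {n : ℕ} {q : Fin n → Fin n → Prop}
    (h : IsNonInterleavingForest q) (i₀ : Fin n) : IsNonInterleavingForest (eraseTop q i₀) where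
  refl i := .inl rfl
  antisymm i j := by
    rintro (h1 | ⟨_, h1⟩) (h2 | ⟨_, h2⟩)
    · exact h1
    · exact h1
    · exact h2.symm
    · exact h.antisymm i j h1 h2
  trans i j k := by
    rintro (rfl | ⟨_, h1⟩) (rfl | ⟨h3, h2⟩)
    · exact .inl rfl
    · exact .inr ⟨h3, h2⟩
    · exact .inr ⟨‹_›, h1⟩
    · exact .inr ⟨h3, h.trans i j k h1 h2⟩
  forest i j k := by
    rintro (rfl | ⟨h3, h1⟩) (rfl | ⟨h4, h2⟩)
    · exact .inl (.inl rfl)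
    · exact .inl (.inr ⟨h4, h2⟩)
    · exact .inr (.inr ⟨h3, h1⟩)
    · exact (h.forest i j k h1 h2).imp (fun h5 => .inr ⟨h4, h5⟩) fun h5 => .inr ⟨h3, h5⟩
  interval i := by
    refine ⟨fun j hj k hk l hl => ?_⟩
    by_cases hi : i = i₀
    · have h1 : j = i := hj.resolve_right fun h1 => h1.1 hi
      have h2 : k = i := hk.resolve_right fun h2 => h2.1 hi
      subst h1 h2
      exact .inl (le_antisymm hl.2 hl.1)
    · refine .inr ⟨hi, (h.interval i).out (x := j) (y := k) ?_ ?_ hl⟩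
      · rcases hj with rfl | hj
        · exact h.refl j
        · exact hj.2
      · rcases hk with rfl | hk
        · exact h.refl k
        · exact hk.2

theorem eq_addTop_eraseTop {n : ℕ} {q : Fin n → Fin n → Prop} {i₀ : Fin n}
    (hq : IsNonInterleavingForest q) (htop : ∀ j, q j i₀) : q = addTop (eraseTop q i₀) i₀ := by
  funext x y
  refine propext ⟨fun h => ?_, ?_⟩
  · by_cases hy : y = i₀
    · exact .inr hy
    · exact .inl (.inr ⟨hy, h⟩)
  · rintro ((rfl | ⟨_, h⟩) | rfl)
    · exact hq.refl x
    · exact h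
    · exact htop x

theorem eq_sumRel {m n : ℕ} {q : Fin (m + n) → Fin (m + n) → Prop}
    (h : ∀ (i : Fin m) (j : Fin n), ¬ q (Fin.castAdd n i) (Fin.natAdd m j) ∧
      ¬ q (Fin.natAdd m j) (Fin.castAdd n i)) :
    q = sumRel (fun i j => q (Fin.castAdd n i) (Fin.castAdd n j))
      (fun i j => q (Fin.natAdd m i) (Fin.natAdd m j)) := by
  funext x y
  induction x using Fin.addCases <;> induction y using Fin.addCases <;> simp [h]

/-- If no element is above all the others, the descendants of some maximal element are the `k < b`,
for some `b` in the range `0 < b < N`; these descendants are then incomparable to the other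
elements. -/
theorem IsNonInterleavingForest.exists_split {N : ℕ} {r : Fin N → Fin N → Prop}
    (hr : IsNonInterleavingForest r) (hN : 0 < N) (htop : ¬ ∃ i, ∀ j, r j i) :
    ∃ b, 0 < b ∧ b < N ∧ ∀ x y : Fin N, x < b → b ≤ y → ¬ r x y ∧ ¬ r y x := by
  classical
  choose lo hi hspan using hr.exists_isSpan
  have hiff : ∀ i j : Fin N, r i j ↔ lo j ≤ i ∧ i < hi j := fun i j => (hspan j).2 i
  let z : Fin N := ⟨0, hN⟩
  obtain ⟨i, hi0, hmax⟩ := (Finset.univ.filter fun i => r z i).exists_max_image hi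
    ⟨z, by simpa using hr.refl z⟩
  simp only [Finset.mem_filter, Finset.mem_univ, true_and] at hi0 hmax
  have h0 : ∀ k, r z k → lo k = 0 := fun k hk => by
    have := ((hiff z k).1 hk).1
    simpa [z] using this
  have hpos : 0 < hi i := ((hiff z i).1 hi0).2
  have hmaximal : ∀ k, r i k → r k i := by
    intro k hik
    have h1 := hr.trans z i k hi0 hik
    have h2 := hmax k h1
    have h3 := (hiff k k).1 (hr.refl k)
    rw [hiff]
    rw [h0 k h1] at h3
    rw [h0 i hi0]
    omega
  have hlt : hi i < N := by
    by_contra hge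
    refine htop ⟨i, fun j => (hiff j i).2 ?_⟩
    rw [h0 i hi0]
    omega
  refine ⟨hi i, hpos, hlt, fun x y hx hy => ?_⟩
  have hxi : r x i := (hiff x i).2 (by rw [h0 i hi0]; omega)
  have hyi : ¬ r y i := fun h => by
    rw [hiff] at h
    omega
  refine ⟨fun hxy => hyi ?_, fun hyx => hyi (hr.trans y x i hyx hxi)⟩
  rcases hr.forest x y i hxy hxi with h | h
  · exact h
  · exact hmaximal y h

namespace NCTree

variable {K : Type*} [CommRing K]

theorem eq_unit (T : NCTree 1) : T = unit := by
  refine posetLE_injective ?_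
  funext x y
  rw [Subsingleton.elim x y]
  simp [T.isNonInterleavingForest_posetLE.refl y, unit.isNonInterleavingForest_posetLE.refl y]

/-- The trees with two edges generate all the non-crossing trees.  If the base is not an edge of
`T`, then `T` is a composite of `star 1`.  If it is an edge, with the number `p`, it is removed.
For `p > 0`, composing `star 0` with the part on the vertices up to `p` and the
remaining part, to which the side `p` has been added, gives the sum of `T` and of trees whose base
has a greater number; for `p = 0`, a composite of `star 2` gives `T` alone. -/
theorem basis_mem_of_composite_mem (M : Submodule K (FreeNCT K))
    (hunit : NCTree.unit.basis K ∈ M)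
    (hcomp : ∀ (k : Fin 3) {m n : ℕ} (S : NCTree m) (S' : NCTree n), S.basis K ∈ M →
      S'.basis K ∈ M → (star k).composite K ![⟨m, S⟩, ⟨n, S'⟩] ∈ M) :
    ∀ {N : ℕ} (T : NCTree N), T.basis K ∈ M := by
  classical
  intro N
  induction N using Nat.strong_induction_on with
  | _ N ih =>
  -- The smaller forests into which the poset of a tree is cut belong to trees already in `M`.
  have part : ∀ {l : ℕ} {r : Fin l → Fin l → Prop}, IsNonInterleavingForest r → 0 < l → l < N →
      ∃ S : NCTree l, S.posetLE = r ∧ S.basis K ∈ M := by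
    intro l r hr h0 hl
    obtain ⟨S, hS⟩ := exists_posetLE_eq hr h0
    exact ⟨S, hS, ih l hl S⟩
  have withTop : ∀ d p (T : NCTree N) (i₀ : Fin N), i₀.val = p → N - p = d →
      (∀ j, T.posetLE j i₀) → T.basis K ∈ M := by
    intro d
    induction d using Nat.strong_induction_on with
    | _ d ihd =>
    intro p T i₀ hp hd htop
    have hT := T.isNonInterleavingForest_posetLE
    have hmax : ∀ j, T.posetLE i₀ j → j = i₀ := fun j hj => hT.antisymm _ _ (htop j) hj
    have hmax' : ∀ j, eraseTop T.posetLE i₀ i₀ j → j = i₀ := by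
      rintro j (h | ⟨_, h⟩)
      · exact h.symm
      · exact hmax j h
    have heq := eq_addTop_eraseTop hT htop
    rcases Nat.eq_zero_or_pos p with rfl | hp0
    · obtain ⟨n', rfl⟩ : ∃ n', N = 1 + n' := ⟨N - 1, by have := T.pos; omega⟩
      obtain rfl : i₀ = Fin.castAdd n' 0 := Fin.ext (by simpa using hp)
      rcases Nat.eq_zero_or_pos n' with rfl | hn'
      · have h : T = unit := eq_unit T
        rw [h]
        exact hunit
      · have hsum := eq_sumRel (q := eraseTop T.posetLE (Fin.castAdd n' 0)) (by
          intro i j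
          rw [Subsingleton.elim i 0]
          refine ⟨?_, ?_⟩
          · rintro (h | ⟨_, h⟩)
            · exact Fin.castAdd_ne_natAdd _ _ h
            · exact Fin.castAdd_ne_natAdd _ _ (hmax _ h).symm
          · rintro (h | ⟨h, _⟩)
            · exact Fin.castAdd_ne_natAdd _ _ h.symm
            · exact h rfl)
        obtain ⟨S', hS', hS'M⟩ := part
          ((hT.eraseTop (Fin.castAdd n' 0)).comap (Fin.strictMono_natAdd 1)) hn' (by omega)
        obtain ⟨S, hS, hSM⟩ : ∃ S : NCTree 1, S.posetLE = _ ∧ S.basis K ∈ M := part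
          ((hT.eraseTop (Fin.castAdd n' 0)).comap (Fin.strictMono_castAdd n')) one_pos (by omega)
        have h1 := hcomp 2 S S' hSM hS'M
        rw [composite_star_two, hS, hS', ← hsum] at h1
        rwa [Finset.sum_eq_single_of_mem T] at h1
        · simp only [Finset.mem_filter, Finset.mem_univ, true_and]
          exact ⟨0, hmax', heq⟩
        · intro R hR hne
          simp only [Finset.mem_filter, Finset.mem_univ, true_and] at hR
          obtain ⟨i, -, hR⟩ := hR
          rw [Subsingleton.elim i 0, ← heq] at hR
          exact absurd (posetLE_injective hR) hne
    · obtain ⟨n', rfl⟩ : ∃ n', N = p + n' := ⟨N - p, by omega⟩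
      have hn' : 0 < n' := by omega
      have : NeZero n' := ⟨hn'.ne'⟩
      obtain rfl : i₀ = Fin.natAdd p 0 := Fin.ext (by simpa using hp)
      have hsum := eq_sumRel (q := eraseTop T.posetLE (Fin.natAdd p (0 : Fin n'))) (by
        intro i j
        have hij : Fin.castAdd n' i ≤ Fin.natAdd p (0 : Fin n') := by
          rw [Fin.le_def]; simp
        have hji : Fin.natAdd p (0 : Fin n') ≤ Fin.natAdd p j := by
          rw [Fin.le_def]; simp
        refine ⟨?_, ?_⟩
        · rintro (h | ⟨hj, h⟩)
          · exact Fin.castAdd_ne_natAdd _ _ h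
          · exact hj (hmax _ ((hT.interval _).out h (hT.refl _) ⟨hij, hji⟩))
        · rintro (h | ⟨hj, h⟩)
          · exact Fin.castAdd_ne_natAdd _ _ h.symm
          · exact hj (hmax _ ((hT.interval _).out (hT.refl _) h ⟨hij, hji⟩)))
      obtain ⟨S, hS, hSM⟩ := part
        ((hT.eraseTop (Fin.natAdd p 0)).comap (Fin.strictMono_castAdd n')) hp0 (by omega)
      obtain ⟨S', hS', hS'M⟩ := part
        ((hT.eraseTop (Fin.natAdd p 0)).comap (Fin.strictMono_natAdd p)) hn' (by omega)
      have h1 := hcomp 0 S S' hSM hS'M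
      rw [composite_star_zero, hS, hS', ← hsum, ← Finset.add_sum_erase _ _ (a := T)
        (by simp only [Finset.mem_filter, Finset.mem_univ, true_and]; exact ⟨0, hmax', heq⟩)] at h1
      refine (Submodule.add_mem_iff_left M (Submodule.sum_mem M fun R hR => ?_)).1 h1
      simp only [Finset.mem_erase, Finset.mem_filter, Finset.mem_univ, true_and] at hR
      obtain ⟨hne, i, -, hR⟩ := hR
      have hi : i ≠ 0 := by
        rintro rfl
        rw [← heq] at hR
        exact hne (posetLE_injective hR)
      have hi : i.val ≠ 0 := fun h => hi (Fin.ext (by simpa using h))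
      exact ihd _ (by omega) (p + i) R (Fin.natAdd p i) (by simp) rfl
        fun j => by rw [hR]; exact .inr rfl
  intro T
  have hT := T.isNonInterleavingForest_posetLE
  by_cases htop : ∃ i, ∀ j, T.posetLE j i
  · obtain ⟨i, hi⟩ := htop
    exact withTop _ _ T i rfl rfl hi
  · obtain ⟨b, hb0, hbN, hsplit⟩ := hT.exists_split T.pos htop
    obtain ⟨n', rfl⟩ : ∃ n', N = b + n' := ⟨N - b, by omega⟩
    have hsum := eq_sumRel (q := T.posetLE) fun i j => hsplit (Fin.castAdd n' i) (Fin.natAdd b j)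
      (by simp) (by simp)
    obtain ⟨S, hS, hSM⟩ := part (hT.comap (Fin.strictMono_castAdd n')) hb0 hbN
    obtain ⟨S', hS', hS'M⟩ := part (hT.comap (Fin.strictMono_natAdd b)) (by omega) (by omega)
    have h1 := hcomp 1 S S' hSM hS'M
    rw [composite_star_one, hS, hS', ← hsum] at h1
    rwa [Finset.sum_eq_single_of_mem T] at h1
    · simp
    · intro R hR hne
      simp only [Finset.mem_filter, Finset.mem_univ, true_and] at hR
      exact absurd (posetLE_injective hR) hne

end NCTree

/-! ### The morphism -/

section Morphism

variable (K : Type*) [CommRing K]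

/-- The linear map sending a non-crossing tree to the sum of the `F_σ` over the linear extensions
`σ` of its poset. -/
noncomputable def linExtMap : FreeNCT K →ₗ[K] FQSym K :=
  Finsupp.linearCombination K fun T => linExtSum K T.2.posetLE

@[simp] theorem linExtMap_basis {n : ℕ} (T : NCTree n) :
    linExtMap K (T.basis K) = linExtSum K T.posetLE := by
  rw [linExtMap, NCTree.basis, Finsupp.linearCombination_single, one_smul]

theorem linExtMap_unit :
    linExtMap K (NCTree.unit.basis K) = FQSym.F K (1 : Equiv.Perm (Fin 1)) := by
  classical
  have h : ∀ σ : Equiv.Perm (Fin 1), IsLinearExtension NCTree.unit.posetLE σ := fun σ i j _ =>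
    (Subsingleton.elim _ _ : σ.symm i = σ.symm j).le
  rw [linExtMap_basis, linExtSum, Finset.filter_true_of_mem fun σ _ => h σ, Fintype.sum_unique]
  rfl

variable {m n : ℕ} (S : NCTree m) (S' : NCTree n)

theorem linExtMap_composite_one : linExtMap K ((NCTree.star 1).composite K ![⟨m, S⟩, ⟨n, S'⟩]) =
    FQSym.prec K (linExtMap K (S.basis K)) (linExtMap K (S'.basis K)) +
      FQSym.succ K (linExtMap K (S.basis K)) (linExtMap K (S'.basis K)) := by
  classical
  have hmn : 0 < m + n := by have := S.pos; omega
  rw [NCTree.composite_star_one, map_sum]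
  simp only [linExtMap_basis]
  rw [prec_add_succ_linExtSum K hmn]
  obtain ⟨R, hR⟩ := NCTree.exists_posetLE_eq
    (S.isNonInterleavingForest_posetLE.sumRel S'.isNonInterleavingForest_posetLE) hmn
  rw [Finset.sum_eq_single_of_mem R (by simpa using hR), hR]
  intro R' hR' hne
  exact absurd (NCTree.posetLE_injective ((Finset.mem_filter.1 hR').2.trans hR.symm)) hne

theorem linExtMap_composite_two : linExtMap K ((NCTree.star 2).composite K ![⟨m, S⟩, ⟨n, S'⟩]) =
    FQSym.prec K (linExtMap K (S.basis K)) (linExtMap K (S'.basis K)) := by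
  classical
  have hmn : 0 < m + n := by have := S.pos; omega
  rw [NCTree.composite_star_two, map_sum]
  simp only [linExtMap_basis]
  rw [prec_linExtSum]
  convert sum_linExtSum_addTop K hmn
    (S.isNonInterleavingForest_posetLE.sumRel S'.isNonInterleavingForest_posetLE) (Fin.castAdd n)

theorem linExtMap_composite_zero : linExtMap K ((NCTree.star 0).composite K ![⟨m, S⟩, ⟨n, S'⟩]) =
    FQSym.succ K (linExtMap K (S.basis K)) (linExtMap K (S'.basis K)) := by
  classical
  have hmn : 0 < m + n := by have := S.pos; omega
  rw [NCTree.composite_star_zero, map_sum]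
  simp only [linExtMap_basis]
  rw [succ_linExtSum]
  convert sum_linExtSum_addTop K hmn
    (S.isNonInterleavingForest_posetLE.sumRel S'.isNonInterleavingForest_posetLE) (Fin.natAdd m)

variable {S S'}

theorem F_one_mem_PBT : FQSym.F K (1 : Equiv.Perm (Fin 1)) ∈ PBT K :=
  Submodule.mem_sInf.2 fun _ hA => hA.1

theorem prec_succ_mem_PBT {x y : FQSym K} (hx : x ∈ PBT K) (hy : y ∈ PBT K) :
    FQSym.prec K x y ∈ PBT K ∧ FQSym.succ K x y ∈ PBT K :=
  ⟨Submodule.mem_sInf.2 fun A hA => (hA.2 x (Submodule.mem_sInf.1 hx A hA) y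
    (Submodule.mem_sInf.1 hy A hA)).1, Submodule.mem_sInf.2 fun A hA => (hA.2 x
    (Submodule.mem_sInf.1 hx A hA) y (Submodule.mem_sInf.1 hy A hA)).2⟩

theorem linExtMap_mem_PBT (x : FreeNCT K) : linExtMap K x ∈ PBT K := by
  have hbasis : ∀ {N : ℕ} (T : NCTree N), T.basis K ∈ (PBT K).comap (linExtMap K) := by
    refine NCTree.basis_mem_of_composite_mem _ ?_ ?_
    · rw [Submodule.mem_comap, linExtMap_unit]
      exact F_one_mem_PBT K
    · intro k m n S S' hS hS'
      have h := prec_succ_mem_PBT K (Submodule.mem_comap.1 hS) (Submodule.mem_comap.1 hS')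
      rw [Submodule.mem_comap]
      fin_cases k
      · exact linExtMap_composite_zero K S S' ▸ h.2
      · exact linExtMap_composite_one K S S' ▸ Submodule.add_mem _ h.1 h.2
      · exact linExtMap_composite_two K S S' ▸ h.1
  rw [← Submodule.mem_comap]
  induction x using Finsupp.induction_linear with
  | zero => exact Submodule.zero_mem _
  | add x y hx hy => exact Submodule.add_mem _ hx hy
  | single T c =>
    rw [← mul_one c, ← smul_eq_mul, ← Finsupp.smul_single]
    exact Submodule.smul_mem _ c (hbasis T.2)

theorem isNCTMorphism_codRestrict_linExtMap :
    IsNCTMorphism ((linExtMap K).codRestrict (PBT K) (linExtMap_mem_PBT K)) where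
  map_generator := linExtMap_unit K
  map_prec S S' := linExtMap_composite_two K S S'
  map_succ S S' := linExtMap_composite_zero K S S'
  map_mul S S' := linExtMap_composite_one K S S'

theorem IsNCTMorphism.unique {K : Type*} [CommRing K] {θ θ' : FreeNCT K →ₗ[K] PBT K}
    (h : IsNCTMorphism θ) (h' : IsNCTMorphism θ') : θ = θ' := by
  have hbasis : ∀ {N : ℕ} (T : NCTree N), T.basis K ∈ LinearMap.eqLocus θ θ' := by
    refine NCTree.basis_mem_of_composite_mem _ ?_ ?_
    · exact Subtype.ext (h.map_generator.trans h'.map_generator.symm)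
    · intro k m n S S' hS hS'
      rw [LinearMap.mem_eqLocus] at hS hS' ⊢
      apply Subtype.ext
      fin_cases k
      · exact (h.map_succ S S').trans (by rw [hS, hS']; exact (h'.map_succ S S').symm)
      · exact (h.map_mul S S').trans (by rw [hS, hS']; exact (h'.map_mul S S').symm)
      · exact (h.map_prec S S').trans (by rw [hS, hS']; exact (h'.map_prec S S').symm)
  refine Finsupp.lhom_ext' fun T => LinearMap.ext_ring ?_
  exact hbasis T.2

end Morphism

open scoped Classical in
theorem mainTheorem1 (K : Type*) [CommRing K] :
    (∃! θ : FreeNCT K →ₗ[K] PBT K, IsNCTMorphism θ) ∧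
    ∀ θ : FreeNCT K →ₗ[K] PBT K, IsNCTMorphism θ →
      ∀ (n : ℕ) (T : NCTree n),
        IsNonInterleavingForest T.posetLE ∧
        (θ (T.basis K) : FQSym K) =
          ∑ σ : Equiv.Perm (Fin n) with IsLinearExtension T.posetLE σ, FQSym.F K σ ∧
        ∃ I : Finset (BinaryTree Unit), IsTamariInterval n I ∧
          (θ (T.basis K) : FQSym K) = ∑ t ∈ I, PBT.P K t := by
  have hmor := isNCTMorphism_codRestrict_linExtMap K
  refine ⟨⟨_, hmor, fun θ hθ => hθ.unique hmor⟩, fun θ hθ n T => ?_⟩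
  have hval : (θ (T.basis K) : FQSym K) = linExtSum K T.posetLE := by
    rw [hθ.unique hmor]
    exact linExtMap_basis K T
  have hT := T.isNonInterleavingForest_posetLE
  obtain ⟨I, hI, hsum⟩ := exists_tamariInterval_linExtSum_eq K hT
  exact ⟨hT, hval, I, hI, hval.trans hsum⟩
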